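/- **Definitions.** A *periodic linear system* $(-A,B,C;E)$ with sign $\varepsilon=\pm1$ consists of complex square matrices of equal size with $BC=\varepsilon(AE+EA)$, $BE=EB$, $EA=AE$ and $\exp(2\pi A)=I$; it has $$W(x,y)=Ce^{-xA}\bigl(I-e^{-xA}Ee^{-xA}\bigr)^{-1}e^{-yA}B .$$ A *periodic linear system with infinite block diagonal matrices and $2\times2$ blocks* is a sequence $(-A_n,B_n,C_n;E_n)$, $n\ge 0$, of periodic linear systems of $2\times2$ matrices with signs $\varepsilon_n=\pm1$, put together as $A=\mathrm{diag}[A_0,A_1,\dots]$ and likewise $B,C,E$, such that the entries of $A,B,C$ are bounded and those of $E$ are absolutely summable; $\varepsilon$ is then the diagonal matrix with diagonal blocks $\varepsilon_nI_2$. Products, exponentials and inverses are taken block by block, $W(x,y)=\mathrm{diag}[W_n(x,y)]$, and $\det(I-e^{-xA}Ee^{-xA})=\prod_n\det(I-e^{-xA_n}E_ne^{-xA_n})$ when this product converges. For $\Im\omega>0$ and $\mathrm q=e^{i\pi\omega}$ let $\theta(x\mid\omega)=\sum_{n\in\mathbf Z}(-1)^n\mathrm q^{n^2}e^{2inx}$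 be Jacobi's theta function. **Theorem 11.3.** Let $\tau$ be an elliptic function, that is, a meromorphic function on $\mathbf C$ with periods $\omega_1,\omega_2$, where $\omega=\omega_2/\omega_1$ has $\Im\omega>0$, and suppose that $\tau$ is not identically zero. Let $f(x)=\tau(\omega_1x/\pi)$ be $\tau$ in the variable normalised so that the periods are $\pi$ and $\pi\omega$ (so $f=\tau$ if $\omega_1=\pi$). (i) There is a periodic linear system $(-A,B,C;E)$ with infinite block diagonal matrices and $2\times2$ blocks such that, for every $x\in\mathbf C$ that is neither a zero nor a pole of $f$, every block of $I-e^{-xA}Ee^{-xA}$ is invertible, the entries of $W(x,x)$ are absolutely summable, and $$\frac{d}{dx}\log f(x)=\operatorname{trace}W(x,x).$$ (ii) There are $m\ge0$, $a_1,\dots,a_m,b_1,\dots,b_m\in\mathbf C$ with $\sum_ja_j=\sum_jb_j$, and $c\ne0$, such that for every $x$ that is not a pole of $f$ all $\theta(x-b_j\mid\omega)$ are nonzero and $$f(x)=c\prod_{j=1}^m\frac{\theta(x-a_j\mid\omega)}{\theta(x-b_j\mid\omega)} .$$ (iii) There are a periodic linear system $(-A,B,C;E)$ with infinite block diagonal matrices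 and $2\times2$ blocks, all of whose signs are $+1$, and a constant $\kappa\ne0$, such that for every $x\in\mathbf C$ the product defining $\det(I-e^{-xA}Ee^{-xA})$ converges absolutely and $$\det\bigl(I-e^{-xA}Ee^{-xA}\bigr)=\kappa\,\theta(x\mid\omega).$$ -/

import Mathlib

/-- A periodic linear system `(-A, B, C; E)` of finite square matrices, with sign `ε = ±1`. -/
structure PeriodicLinearSystem (ι : Type*) [Fintype ι] [DecidableEq ι] where
  A : Matrix ι ι ℂ
  B : Matrix ι ι ℂ
  C : Matrix ι ι ℂ
  E : Matrix ι ι ℂ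
  ε : ℂ
  sign : ε = 1 ∨ ε = -1
  mul_BC : B * C = ε • (A * E + E * A)
  comm_BE : B * E = E * B
  comm_EA : E * A = A * E
  exp_A : NormedSpace.exp ((2 * (Real.pi : ℂ)) • A) = 1

namespace PeriodicLinearSystem

variable {ι : Type*} [Fintype ι] [DecidableEq ι]

/-- The matrix `e^{-xA}`. -/
noncomputable def expA (S : PeriodicLinearSystem ι) (x : ℂ) : Matrix ι ι ℂ :=
  NormedSpace.exp ((-x) • S.A)

/-- The matrix `I - e^{-xA} E e^{-xA}`. -/
noncomputable def pencil (S : PeriodicLinearSystem ι) (x : ℂ) : Matrix ι ι ℂ :=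
  1 - S.expA x * S.E * S.expA x

/-- `W(x,y) = C e^{-xA} (I - e^{-xA} E e^{-xA})⁻¹ e^{-yA} B`; it is meaningful where
`I - e^{-xA} E e^{-xA}` is invertible. -/
noncomputable def W (S : PeriodicLinearSystem ι) (x y : ℂ) : Matrix ι ι ℂ :=
  S.C * S.expA x * (S.pencil x)⁻¹ * S.expA y * S.B

end PeriodicLinearSystem

/-- A periodic linear system whose matrices `A, B, C, E` are infinite block diagonal with `2 × 2`
blocks: block number `n` is a periodic linear system of `2 × 2` matrices with its own sign, so that
`ε` becomes a diagonal matrix of signs, constant on blocks. Rows and columns are indexed by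
`Fin 2 × ℕ` (position inside the block, number of the block). The entries of `A, B, C` are bounded
(as the blocks have size `2`, they are bounded operators on `ℓ²`) and the entries of `E` are
absolutely summable (so `E` is trace class). -/
structure BlockPeriodicLinearSystem where
  block : ℕ → PeriodicLinearSystem (Fin 2)
  bounded_A : ∃ K : ℝ, ∀ i j, ‖Matrix.blockDiagonal (fun n => (block n).A) i j‖ ≤ K
  bounded_B : ∃ K : ℝ, ∀ i j, ‖Matrix.blockDiagonal (fun n => (block n).B) i j‖ ≤ K
  bounded_C : ∃ K : ℝ, ∀ i j, ‖Matrix.blockDiagonal (fun n => (block n).C) i j‖ ≤ K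
  summable_E : Summable fun p : (Fin 2 × ℕ) × (Fin 2 × ℕ) =>
    ‖Matrix.blockDiagonal (fun n => (block n).E) p.1 p.2‖

namespace BlockPeriodicLinearSystem

/-- Invertibility of the infinite matrix `I - e^{-xA} E e^{-xA}`: every block is invertible. (The
blocks tend to `I`, so the inverses of the blocks are then automatically bounded.) -/
def Regular (S : BlockPeriodicLinearSystem) (x : ℂ) : Prop :=
  ∀ n, IsUnit ((S.block n).pencil x)

/-- The infinite matrix `W(x,y) = C e^{-xA} (I - e^{-xA} E e^{-xA})⁻¹ e^{-yA} B`. Products, inverses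
and exponentials of block diagonal matrices are formed block by block. -/
noncomputable def W (S : BlockPeriodicLinearSystem) (x y : ℂ) :
    Matrix (Fin 2 × ℕ) (Fin 2 × ℕ) ℂ :=
  Matrix.blockDiagonal fun n => (S.block n).W x y

/-- `det (I - e^{-xA} E e^{-xA}) = d`, the convergent product of the determinants of the blocks. -/
def HasDet (S : BlockPeriodicLinearSystem) (x d : ℂ) : Prop :=
  HasProd (fun n => ((S.block n).pencil x).det) d

end BlockPeriodicLinearSystem

/-- The infinite matrix `M` is trace class (its entries are absolutely summable) and its trace, the
sum of its diagonal entries, is `t`. -/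
def Matrix.HasTrace {κ : Type*} (M : Matrix κ κ ℂ) (t : ℂ) : Prop :=
  (Summable fun p : κ × κ => ‖M p.1 p.2‖) ∧ HasSum (fun i => M i i) t

/-- `τ` is an elliptic function with periods `ω₁, ω₂`, numbered so that `Im (ω₂ / ω₁) > 0`:
a meromorphic function on `ℂ`, not identically zero (in the sense of meromorphic functions, whose
values at isolated points do not matter), with these two periods. -/
structure IsElliptic (ω₁ ω₂ : ℂ) (τ : ℂ → ℂ) : Prop where
  im_pos : 0 < (ω₂ / ω₁).im
  meromorphic : Meromorphic τ
  periodic₁ : Function.Periodic τ ω₁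
  periodic₂ : Function.Periodic τ ω₂
  ne_zero : ∃ x, AnalyticAt ℂ τ x ∧ τ x ≠ 0

/-- The Jacobi theta function `θ(x | ω) = ∑ (-1)ⁿ q^{n²} e^{2inx}`, `n ∈ ℤ`, with nome
`q = e^{iπω}`. -/
noncomputable def ellipticTheta (ω x : ℂ) : ℂ :=
  jacobiTheta₂ (x / (Real.pi : ℂ) + 1 / 2) ω

open Complex Filter Topology

/-! Everything rests on the product `κ θ(x) = ∏ (1 - q^{2n+1} e^{2ix}) (1 - q^{2n+1} e^{-2ix})` with
some `κ ≠ 0`. Its factors are the determinants of the blocks with `A = diag(i, -i)` and `E =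
q^{2n+1} I`, which gives (iii).

The product formula is proved without computing `κ` (`exists_thetaProd_eq_mul_ellipticTheta`): both
sides have the same multipliers under `π` and `πω`, the product has only simple zeros, and `θ`
vanishes at each of them. The quotient is thus entire and doubly periodic, hence constant.

For (ii), let `G` be the product of powers of shifted theta functions with the divisor of `f`. Then
`f / G` extends to a nowhere vanishing entire function, periodic under `π` and quasi-periodic under
`πω`, so it is `c e^{2ilx}` (`exists_eq_exp_of_quasiperiodic`). Comparing multipliers shows that
there are as many zeros as poles and that their sums agree modulo the lattice. Moving one zero by a
lattice vector absorbs the exponential and makes the sums equal. No residue calculus is needed.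

For (i), take diagonal blocks with `B = I`. Then the trace of `W(x,x)` is the sum over blocks of `ε`
times the logarithmic derivative of the block determinant. Replacing `q^{2n+1}` by `q^{2n+1}
e^{±2id}` translates the variable by `d`. Interleaving one such system for each zero (sign `+1`) and
each pole (sign `-1`) gives the logarithmic derivative of (ii). -/

/-! ### The period lattice and its fundamental parallelogram. -/

/-- `w` lies in the period lattice `πℤ + πωℤ`. -/
def InLattice (ω w : ℂ) : Prop :=
  ∃ m n : ℤ, w = m * (Real.pi : ℂ) + n * ((Real.pi : ℂ) * ω)

/-- The point of the plane with real coordinates `p` in the basis `π, πω`. -/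
noncomputable def latticePoint (ω : ℂ) (p : ℝ × ℝ) : ℂ :=
  p.1 * (Real.pi : ℂ) + p.2 * ((Real.pi : ℂ) * ω)

lemma continuous_latticePoint (ω : ℂ) : Continuous (latticePoint ω) := by
  unfold latticePoint; fun_prop

lemma latticePoint_injective {ω : ℂ} (hω : 0 < ω.im) : Function.Injective (latticePoint ω) := by
  rintro ⟨s, t⟩ ⟨s', t'⟩ h
  have him := congrArg im h
  have hre := congrArg re h
  simp [latticePoint] at him hre
  obtain rfl : t = t' := by
    rcases him with h | h
    · exact h
    · exact absurd h hω.ne'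
  simpa [Real.pi_ne_zero] using hre

lemma latticePoint_surjective {ω : ℂ} (hω : 0 < ω.im) : Function.Surjective (latticePoint ω) := by
  intro z
  have hpi := Real.pi_ne_zero
  have hω' := hω.ne'
  obtain ⟨t, ht⟩ : ∃ t : ℝ, t * (Real.pi * ω.im) = z.im := ⟨z.im / (Real.pi * ω.im), by field_simp⟩
  obtain ⟨s, hs⟩ : ∃ s : ℝ, s * Real.pi = z.re - t * (Real.pi * ω.re) :=
    ⟨(z.re - t * (Real.pi * ω.re)) / Real.pi, by field_simp⟩
  refine ⟨(s, t), Complex.ext ?_ ?_⟩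
  · simp [latticePoint]; linear_combination hs
  · simp [latticePoint]; linear_combination ht

/-- The half-open fundamental parallelogram. -/
def fundamentalCell (ω : ℂ) : Set ℂ :=
  latticePoint ω '' (Set.Ico 0 1 ×ˢ Set.Ico 0 1)

lemma exists_mem_fundamentalCell {ω : ℂ} (hω : 0 < ω.im) (z : ℂ) :
    ∃ r ∈ fundamentalCell ω, InLattice ω (z - r) := by
  obtain ⟨⟨s, t⟩, rfl⟩ := latticePoint_surjective hω z
  refine ⟨_, ⟨(Int.fract s, Int.fract t), ⟨⟨Int.fract_nonneg _, Int.fract_lt_one _⟩,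
    ⟨Int.fract_nonneg _, Int.fract_lt_one _⟩⟩, rfl⟩, ⌊s⌋, ⌊t⌋, ?_⟩
  have hs : (s : ℂ) = ⌊s⌋ + (Int.fract s : ℝ) := by exact_mod_cast (Int.floor_add_fract s).symm
  have ht : (t : ℂ) = ⌊t⌋ + (Int.fract t : ℝ) := by exact_mod_cast (Int.floor_add_fract t).symm
  simp only [latticePoint]
  rw [hs, ht]
  ring

lemma eq_of_mem_fundamentalCell {ω : ℂ} (hω : 0 < ω.im) {r r' : ℂ} (hr : r ∈ fundamentalCell ω)
    (hr' : r' ∈ fundamentalCell ω) (h : InLattice ω (r - r')) : r = r' := by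
  obtain ⟨⟨s, t⟩, ⟨⟨hs0, hs1⟩, ⟨ht0, ht1⟩⟩, rfl⟩ := hr
  obtain ⟨⟨s', t'⟩, ⟨⟨hs0', hs1'⟩, ⟨ht0', ht1'⟩⟩, rfl⟩ := hr'
  obtain ⟨m, n, h⟩ := h
  have h' : latticePoint ω (s, t) = latticePoint ω (s' + m, t' + n) := by
    rw [← sub_add_cancel (latticePoint ω (s, t)) (latticePoint ω (s', t')), h]
    simp [latticePoint]; ring
  obtain ⟨h1, h2⟩ := Prod.mk.injEq _ _ _ _ ▸ latticePoint_injective hω h'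
  have hm : m = 0 := by
    have : (m : ℝ) < 1 := by linarith
    have : (-1 : ℝ) < m := by linarith
    have : m < 1 := by exact_mod_cast ‹(m : ℝ) < 1›
    have : -1 < m := by exact_mod_cast ‹(-1 : ℝ) < m›
    omega
  have hn : n = 0 := by
    have : (n : ℝ) < 1 := by linarith
    have : (-1 : ℝ) < n := by linarith
    have : n < 1 := by exact_mod_cast ‹(n : ℝ) < 1›
    have : -1 < n := by exact_mod_cast ‹(-1 : ℝ) < n›
    omega
  simp [h1, h2, hm, hn]

lemma InLattice.symm {ω z w : ℂ} (h : InLattice ω (z - w)) : InLattice ω (w - z) := by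
  obtain ⟨m, n, h⟩ := h
  exact ⟨-m, -n, by push_cast; linear_combination -h⟩

lemma InLattice.trans {ω x y z : ℂ} (h : InLattice ω (x - y)) (h' : InLattice ω (y - z)) :
    InLattice ω (x - z) := by
  obtain ⟨m, n, h⟩ := h
  obtain ⟨m', n', h'⟩ := h'
  exact ⟨m + m', n + n', by push_cast; linear_combination h + h'⟩

/-- Functions with periods `π` and `πω` are constant on the classes modulo the lattice. -/
lemma InLattice.eq_of_periodic {α : Type*} {ω : ℂ} {F : ℂ → α}
    (h₁ : Function.Periodic F (Real.pi : ℂ))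
    (h₂ : Function.Periodic F ((Real.pi : ℂ) * ω)) {z w : ℂ} (h : InLattice ω (z - w)) :
    F z = F w := by
  obtain ⟨m, n, h⟩ := h
  rw [show z = w + m * (Real.pi : ℂ) + n * ((Real.pi : ℂ) * ω) by linear_combination h,
    h₂.int_mul n, h₁.int_mul m]

lemma exists_isCompact_fundamentalCell_subset (ω : ℂ) : ∃ K, IsCompact K ∧ fundamentalCell ω ⊆ K :=
  ⟨latticePoint ω '' (Set.Icc 0 1 ×ˢ Set.Icc 0 1),
    (isCompact_Icc.prod isCompact_Icc).image (continuous_latticePoint ω),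
    Set.image_mono (Set.prod_mono Set.Ico_subset_Icc_self Set.Ico_subset_Icc_self)⟩

/-! ### Entire functions that are periodic or quasi-periodic. -/

/-- **Liouville**: an entire function with periods `π` and `πω` is constant. -/
lemma Differentiable.eq_const_of_periodic {ω : ℂ} (hω : 0 < ω.im) {F : ℂ → ℂ}
    (hF : Differentiable ℂ F) (h₁ : Function.Periodic F (Real.pi : ℂ))
    (h₂ : Function.Periodic F ((Real.pi : ℂ) * ω)) : ∃ c, ∀ x, F x = c := by
  obtain ⟨K, hK, hsub⟩ := exists_isCompact_fundamentalCell_subset ω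
  refine hF.exists_const_forall_eq_of_bounded ((hK.image hF.continuous).isBounded.subset ?_)
  rintro _ ⟨z, rfl⟩
  obtain ⟨r, hr, hz⟩ := exists_mem_fundamentalCell hω z
  exact ⟨r, hsub hr, (hz.eq_of_periodic h₁ h₂).symm⟩

/-- A nowhere vanishing entire function that is `π`-periodic and quasi-periodic under `πω` is an
exponential. -/
lemma exists_eq_exp_of_quasiperiodic {ω : ℂ} (hω : 0 < ω.im) {h : ℂ → ℂ}
    (hd : Differentiable ℂ h) (h0 : ∀ x, h x ≠ 0) (h₁ : Function.Periodic h (Real.pi : ℂ))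
    {C k : ℂ} (h₂ : ∀ x, h (x + (Real.pi : ℂ) * ω) = C * cexp (k * x) * h x) :
    k = 0 ∧ ∃ (c : ℂ) (l : ℤ), c ≠ 0 ∧ ∀ x, h x = c * cexp (2 * I * l * x) := by
  have hpi : (Real.pi : ℂ) ≠ 0 := by exact_mod_cast Real.pi_ne_zero
  have hC : C ≠ 0 := by
    rintro rfl
    exact h0 _ ((h₂ 0).trans (by simp))
  have hd' : Differentiable ℂ (deriv h) := (hd.contDiff (n := 2)).differentiable_deriv_two
  -- The logarithmic derivative turns the multiplier into the additive constant `k`, so `L'` is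
  -- doubly periodic and constant. The period `π` then kills the linear part of `L`, and the second
  -- period forces `k = 0`.
  set L : ℂ → ℂ := fun x => deriv h x / h x with hL
  have hLd : Differentiable ℂ L := hd'.div hd h0
  have hL₁ : ∀ x, L (x + (Real.pi : ℂ)) = L x := by
    intro x
    have e : deriv h (x + (Real.pi : ℂ)) = deriv h x := by
      rw [← deriv_comp_add_const]
      exact congrArg (fun g => deriv g x) (funext h₁)
    simp only [hL, e, h₁ x]
  have hL₂ : ∀ x, L (x + (Real.pi : ℂ) * ω) = L x + k := by
    intro x
    have e : deriv h (x + (Real.pi : ℂ) * ω) =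
        C * (cexp (k * x) * k) * h x + C * cexp (k * x) * deriv h x := by
      rw [← deriv_comp_add_const, funext h₂]
      have h1 : HasDerivAt (fun x => C * cexp (k * x)) (C * (cexp (k * x) * k)) x :=
        (((hasDerivAt_id x).const_mul k).cexp.const_mul C).congr_deriv (by simp)
      exact (h1.mul (hd x).hasDerivAt).deriv
    simp only [hL, e, h₂ x]
    have := h0 x
    have := exp_ne_zero (k * x)
    field_simp
    ring
  have hL' : Differentiable ℂ (deriv L) := (hLd.contDiff (n := 2)).differentiable_deriv_two
  obtain ⟨α, hα⟩ : ∃ α, ∀ x, deriv L x = α := by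
    refine hL'.eq_const_of_periodic hω (fun x => ?_) (fun x => ?_)
    · rw [← deriv_comp_add_const]
      exact congrArg (fun g => deriv g x) (funext hL₁)
    · rw [← deriv_comp_add_const, funext hL₂]
      simp
  have hLlin : ∀ x, L x = L 0 + α * x := by
    intro x
    have hc : ∀ x y, L x - α * x = L y - α * y := is_const_of_deriv_eq_zero
      (hLd.sub (by fun_prop)) (fun x => by
        have h1 : HasDerivAt (fun x : ℂ => L x - α * x) (deriv L x - α * 1) x :=
          (hLd x).hasDerivAt.sub ((hasDerivAt_id x).const_mul α)
        rw [h1.deriv, hα]; simp)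
    have := hc x 0
    simp at this
    linear_combination this
  have hα0 : α = 0 := by
    have := hL₁ 0
    rw [hLlin] at this
    simpa [hpi] using this
  have hLc : ∀ x, L x = L 0 := fun x => by rw [hLlin, hα0]; simp
  have hk : k = 0 := by
    have := hL₂ 0
    rw [hLc] at this
    simpa using this
  have hexp : ∀ x, h x = h 0 * cexp (L 0 * x) := by
    intro x
    have hc : ∀ x y, h x * cexp (-(L 0 * x)) = h y * cexp (-(L 0 * y)) :=
      is_const_of_deriv_eq_zero (hd.mul (by fun_prop)) (fun x => by
        have h2 : HasDerivAt (fun x => cexp (-(L 0 * x))) (cexp (-(L 0 * x)) * (-(L 0))) x :=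
          (((hasDerivAt_id x).const_mul (L 0)).neg.cexp).congr_deriv (by simp)
        have h1 := ((hd x).hasDerivAt.mul h2).deriv
        have h3 : deriv h x = L 0 * h x := by
          rw [← hLc x]; simp only [hL]; have := h0 x; field_simp
        refine h1.trans ?_
        rw [h3]; ring)
    have := hc x 0
    simp only [mul_zero, neg_zero, exp_zero, mul_one, Complex.exp_neg] at this
    rw [← this]
    have := exp_ne_zero (L 0 * x)
    field_simp
  refine ⟨hk, h 0, ?_⟩
  have hper := h₁ 0
  rw [hexp] at hper
  have h00 := h0 0
  have : cexp (L 0 * (Real.pi : ℂ)) = 1 := by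
    have : h 0 * cexp (L 0 * (Real.pi : ℂ)) = h 0 * 1 := by simpa using hper
    exact mul_left_cancel₀ h00 this
  obtain ⟨l, hl⟩ := Complex.exp_eq_one_iff.1 this
  have hL0 : L 0 = 2 * I * l := by
    apply mul_right_cancel₀ hpi
    rw [hl]; ring
  exact ⟨l, h00, fun x => by rw [hexp x, hL0]⟩

/-! ### Entire representatives of meromorphic functions. -/

/-- A meromorphic function on the plane without poles extends to an entire function. -/
lemma Meromorphic.exists_differentiable {F : ℂ → ℂ} (hF : Meromorphic F)
    (hord : ∀ x, 0 ≤ meromorphicOrderAt F x) :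
    ∃ h : ℂ → ℂ, Differentiable ℂ h ∧ (∀ x, h =ᶠ[𝓝[≠] x] F) ∧
      ∀ x, meromorphicOrderAt F x = 0 → h x ≠ 0 := by
  have hF' : MeromorphicOn F Set.univ := fun x _ => hF x
  have hNF := meromorphicNFOn_toMeromorphicNFOn F Set.univ
  have ho : ∀ x, meromorphicOrderAt (toMeromorphicNFOn F Set.univ) x = meromorphicOrderAt F x :=
    fun x => meromorphicOrderAt_toMeromorphicNFOn hF' (Set.mem_univ x)
  refine ⟨toMeromorphicNFOn F Set.univ, fun x => ?_, fun x => ?_, fun x hx => ?_⟩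
  · exact ((hNF (Set.mem_univ x)).meromorphicOrderAt_nonneg_iff_analyticAt.1
      ((ho x).symm ▸ hord x)).differentiableAt
  · exact hF'.toMeromorphicNFOn_eq_self_on_nhdsNE (Set.mem_univ x)
  · exact (hNF (Set.mem_univ x)).meromorphicOrderAt_eq_zero_iff.1 ((ho x).trans hx)

/-- Continuous functions that agree on a punctured neighbourhood agree at the point. -/
lemma ContinuousAt.eq_of_eventuallyEq_nhdsNE {f g : ℂ → ℂ} {x : ℂ} (hf : ContinuousAt f x)
    (hg : ContinuousAt g x) (h : f =ᶠ[𝓝[≠] x] g) : f x = g x :=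
  tendsto_nhds_unique ((hf.tendsto.mono_left nhdsWithin_le_nhds).congr' h)
    (hg.tendsto.mono_left nhdsWithin_le_nhds)

lemma eventually_nhdsNE_add {p : ℂ → Prop} {x c : ℂ} (h : ∀ᶠ y in 𝓝[≠] (x + c), p y) :
    ∀ᶠ y in 𝓝[≠] x, p (y + c) := by
  have : Tendsto (fun y => y + c) (𝓝[≠] x) (𝓝[≠] (x + c)) := by
    apply tendsto_nhdsWithin_of_tendsto_nhds_of_eventually_within
    · exact (((continuous_id.add continuous_const).tendsto x).mono_left nhdsWithin_le_nhds)
    · filter_upwards [self_mem_nhdsWithin] with y hy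
      simpa using hy
  exact this.eventually h

/-- A multiplicative transformation law passes to an entire representative. -/
lemma apply_add_eq_of_eventuallyEq_nhdsNE {F h u : ℂ → ℂ} {c : ℂ} (hh : Continuous h)
    (hu : Continuous u) (hF : ∀ x, h =ᶠ[𝓝[≠] x] F)
    (hFc : ∀ x, ∀ᶠ y in 𝓝[≠] x, F (y + c) = u y * F y) (x : ℂ) : h (x + c) = u x * h x := by
  refine ContinuousAt.eq_of_eventuallyEq_nhdsNE (f := fun y => h (y + c)) (g := fun y => u y * h y)
    (by fun_prop) (by fun_prop) ?_
  filter_upwards [hF x, eventually_nhdsNE_add (hF (x + c)), hFc x] with y h1 h2 h3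
  rw [h2, h1, h3]

/-! ### The `q`-Pochhammer product and its logarithmic derivative. -/

/-- The infinite `q`-Pochhammer symbol `∏ (1 - z pⁿ)`. -/
noncomputable def qProd (p z : ℂ) : ℂ := ∏' n : ℕ, (1 - z * p ^ n)

section qProd

variable {p : ℂ}

lemma summable_norm_mul_pow (hp : ‖p‖ < 1) (z : ℂ) : Summable fun n : ℕ => ‖z * p ^ n‖ := by
  simpa using (summable_geometric_of_lt_one (norm_nonneg p) hp).mul_left ‖z‖

lemma multipliable_qProd (hp : ‖p‖ < 1) (z : ℂ) : Multipliable fun n : ℕ => 1 - z * p ^ n := by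
  simpa [sub_eq_add_neg] using multipliable_one_add_of_summable (f := fun n : ℕ => -(z * p ^ n))
    (by simpa using summable_norm_mul_pow hp z)

lemma hasProd_qProd (hp : ‖p‖ < 1) (z : ℂ) : HasProd (fun n : ℕ => 1 - z * p ^ n) (qProd p z) :=
  (multipliable_qProd hp z).hasProd

lemma qProd_ne_zero (hp : ‖p‖ < 1) {z : ℂ} (hz : ∀ n : ℕ, 1 - z * p ^ n ≠ 0) : qProd p z ≠ 0 := by
  simpa [qProd, sub_eq_add_neg] using
    tprod_one_add_ne_zero_of_summable (f := fun n : ℕ => -(z * p ^ n))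
    (by simpa [sub_eq_add_neg] using hz) (by simpa using summable_norm_mul_pow hp z)

lemma qProd_eq_zero_iff (hp : ‖p‖ < 1) {z : ℂ} : qProd p z = 0 ↔ ∃ n : ℕ, 1 - z * p ^ n = 0 := by
  refine ⟨fun h => ?_, fun h => tprod_of_exists_eq_zero h⟩
  by_contra! hc
  exact qProd_ne_zero hp hc h

lemma qProd_eq_mul (hp : ‖p‖ < 1) (z : ℂ) : qProd p z = (1 - z) * qProd p (p * z) := by
  have h : (fun n : ℕ => 1 - p * z * p ^ n) = fun n : ℕ => 1 - z * p ^ (n + 1) := by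
    ext n; ring
  have := tprod_eq_zero_mul' (f := fun n : ℕ => 1 - z * p ^ n)
    (h ▸ multipliable_qProd hp (p * z))
  rw [qProd, this, qProd, h]
  simp

/-- Weierstrass test with majorant `R |p|ⁿ`. It yields both holomorphy of the product and termwise
logarithmic differentiation. -/
lemma multipliableLocallyUniformlyOn_qProd (hp : ‖p‖ < 1) (R : ℝ) :
    MultipliableLocallyUniformlyOn (fun (n : ℕ) (z : ℂ) => 1 - z * p ^ n) (Metric.ball 0 R) := by
  have := Summable.multipliableLocallyUniformlyOn_nat_one_add
    (f := fun (n : ℕ) (z : ℂ) => -(z * p ^ n)) (K := Metric.ball 0 R) (u := fun n => R * ‖p‖ ^ n)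
    Metric.isOpen_ball ((summable_geometric_of_lt_one (norm_nonneg p) hp).mul_left R)
    (Eventually.of_forall fun n z hz => by
      have : ‖z‖ ≤ R := by simpa using (Metric.mem_ball.1 hz).le
      simp only [norm_neg, norm_mul, norm_pow]
      gcongr) (fun n => by fun_prop)
  simpa [sub_eq_add_neg] using this

lemma differentiable_qProd (hp : ‖p‖ < 1) : Differentiable ℂ (qProd p) := fun z =>
  ((multipliableLocallyUniformlyOn_qProd hp (‖z‖ + 1)).hasProdLocallyUniformlyOn.differentiableOn
    (.of_forall fun _ => by
      simpa [Finset.prod_fn] using DifferentiableOn.finsetProd (fun _ _ => by fun_prop))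
    Metric.isOpen_ball).differentiableAt (Metric.isOpen_ball.mem_nhds (by simp))

/-- All but finitely many `u i` have norm below `1/2`, and there the denominator costs at most a
factor `2`. -/
lemma summable_norm_div_one_sub {ι : Type*} {u : ι → ℂ} (hu : Summable fun i => ‖u i‖) :
    Summable fun i => ‖u i / (1 - u i)‖ := by
  refine Summable.of_norm_bounded_eventually (hu.mul_left 2) ?_
  have h : ∀ᶠ i in cofinite, ‖u i‖ < 1 / 2 :=
    hu.tendsto_cofinite_zero.eventually_lt_const (by norm_num)
  filter_upwards [h] with i hi
  have h1 : 1 / 2 ≤ ‖1 - u i‖ := by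
    have := norm_sub_norm_le (1 : ℂ) (u i)
    rw [norm_one] at this
    linarith
  rw [norm_norm, norm_div, div_le_iff₀ (by linarith)]
  nlinarith [norm_nonneg (u i)]

/-- The logarithmic derivative of the product, multiplied by the variable. -/
lemma hasSum_logDeriv_qProd (hp : ‖p‖ < 1) {z : ℂ} (hz : qProd p z ≠ 0) :
    HasSum (fun n : ℕ => z * p ^ n / (1 - z * p ^ n)) (-z * logDeriv (qProd p) z) := by
  -- The termwise logarithmic derivatives are written with a factor `z⁻¹` below, so `z = 0` is
  -- treated apart.
  rcases eq_or_ne z 0 with rfl | hz0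
  · simp
  have hne : ∀ n : ℕ, 1 - z * p ^ n ≠ 0 := fun n hn => hz ((qProd_eq_zero_iff hp).2 ⟨n, hn⟩)
  have hs : Summable fun n : ℕ => z * p ^ n / (1 - z * p ^ n) :=
    (summable_norm_div_one_sub (summable_norm_mul_pow hp z)).of_norm
  have hl : ∀ n : ℕ, logDeriv (fun z : ℂ => 1 - z * p ^ n) z =
      -z⁻¹ * (z * p ^ n / (1 - z * p ^ n)) := by
    intro n
    have : HasDerivAt (fun z : ℂ => 1 - z * p ^ n) (-(1 * p ^ n)) z :=
      ((hasDerivAt_id z).mul_const (p ^ n)).const_sub 1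
    rw [logDeriv_apply, this.deriv]
    have := hne n
    field_simp
  have key := logDeriv_tprod_eq_tsum (s := Metric.ball 0 (‖z‖ + 1)) Metric.isOpen_ball
    (x := z) (by simp) (f := fun (n : ℕ) (z : ℂ) => 1 - z * p ^ n) hne (fun n => by fun_prop)
    (by simp only [hl]; exact hs.mul_left _) (multipliableLocallyUniformlyOn_qProd hp _) hz
  have key' : logDeriv (qProd p) z = _ := key
  rw [key']
  simp only [hl]
  rw [tsum_mul_left]
  convert! hs.hasSum using 1
  field_simp

end qProd

/-! ### The theta product: multipliers and zeros. -/

/-- The nome `q = e^{iπω}`. -/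
noncomputable def nome (ω : ℂ) : ℂ := cexp (Real.pi * I * ω)

lemma norm_nome_lt_one {ω : ℂ} (hω : 0 < ω.im) : ‖nome ω‖ < 1 := by
  rw [nome, Complex.norm_exp, Real.exp_lt_one_iff]
  simp
  positivity

lemma norm_nome_sq_lt_one {ω : ℂ} (hω : 0 < ω.im) : ‖nome ω ^ 2‖ < 1 := by
  rw [norm_pow]
  exact pow_lt_one₀ (norm_nonneg _) (norm_nome_lt_one hω) two_ne_zero

/-- The product `∏ (1 - q^{2n+1} e^{2ix}) (1 - q^{2n+1} e^{-2ix})`. -/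
noncomputable def thetaProd (ω x : ℂ) : ℂ :=
  qProd (nome ω ^ 2) (nome ω * cexp (2 * I * x)) * qProd (nome ω ^ 2) (nome ω * cexp (-2 * I * x))

section thetaProd

variable {ω : ℂ}

lemma exp_two_I_mul_add_pi (x : ℂ) : cexp (2 * I * (x + Real.pi)) = cexp (2 * I * x) := by
  rw [← Complex.exp_periodic (2 * I * x)]; ring_nf

lemma exp_neg_two_I_mul_add_pi (x : ℂ) : cexp (-2 * I * (x + Real.pi)) = cexp (-2 * I * x) := by
  rw [← Complex.exp_periodic (-2 * I * (x + Real.pi))]; ring_nf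

lemma thetaProd_periodic (ω : ℂ) : Function.Periodic (thetaProd ω) (Real.pi : ℂ) := by
  intro x
  simp only [thetaProd, exp_two_I_mul_add_pi, exp_neg_two_I_mul_add_pi]

/-- The shift multiplies one argument by `p = q²` and divides the other by `p`, so one product loses
its first factor and the other gains one. With `u = e^{-2ix}` the ratio is `(1 - u/q) / (1 - q/u) =
-u/q`; the proof clears this denominator. -/
lemma thetaProd_add_pi_mul (hω : 0 < ω.im) (x : ℂ) :
    thetaProd ω (x + Real.pi * ω) = -(nome ω)⁻¹ * cexp (-2 * I * x) * thetaProd ω x := by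
  have hp := norm_nome_sq_lt_one hω
  have hq : nome ω ≠ 0 := exp_ne_zero _
  have e1 : cexp (2 * I * (x + Real.pi * ω)) = nome ω ^ 2 * cexp (2 * I * x) := by
    rw [nome, ← Complex.exp_nat_mul, ← Complex.exp_add]; push_cast; ring_nf
  have e2 : cexp (-2 * I * (x + Real.pi * ω)) = (nome ω ^ 2)⁻¹ * cexp (-2 * I * x) := by
    rw [nome, ← Complex.exp_nat_mul, ← Complex.exp_neg, ← Complex.exp_add]; push_cast; ring_nf
  have e3 : cexp (-2 * I * x) * cexp (2 * I * x) = 1 := by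
    rw [← Complex.exp_add]; ring_nf; simp
  simp only [thetaProd]
  rw [e1, e2, qProd_eq_mul hp (nome ω * cexp (2 * I * x)),
    qProd_eq_mul hp (nome ω * ((nome ω ^ 2)⁻¹ * cexp (-2 * I * x)))]
  rw [show nome ω ^ 2 * (nome ω * ((nome ω ^ 2)⁻¹ * cexp (-2 * I * x))) =
    nome ω * cexp (-2 * I * x) by field_simp,
    show nome ω * (nome ω ^ 2 * cexp (2 * I * x)) = nome ω ^ 2 * (nome ω * cexp (2 * I * x)) by ring]
  generalize qProd (nome ω ^ 2) _ = A
  generalize qProd (nome ω ^ 2) _ = B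
  generalize cexp (-2 * I * x) = u at e3 ⊢
  field_simp
  linear_combination (-A * B * nome ω) * e3

lemma differentiable_thetaProd (hω : 0 < ω.im) : Differentiable ℂ (thetaProd ω) := by
  have h := differentiable_qProd (norm_nome_sq_lt_one hω)
  unfold thetaProd
  exact (h.comp (by fun_prop)).mul (h.comp (by fun_prop))

/-- The product vanishes only at the points `πω/2 + mπ + nπω`. -/
lemma inLattice_of_thetaProd_eq_zero (hω : 0 < ω.im) {x : ℂ} (hx : thetaProd ω x = 0) :
    InLattice ω (x - Real.pi * ω / 2) := by
  have hp := norm_nome_sq_lt_one hω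
  have hpow : ∀ (n : ℕ) (y : ℂ), nome ω * cexp y * (nome ω ^ 2) ^ n =
      cexp ((2 * n + 1) * (Real.pi * I * ω) + y) := by
    intro n y
    rw [Complex.exp_add, ← pow_mul, nome, ← Complex.exp_nat_mul, mul_right_comm, ← Complex.exp_add]
    push_cast; ring_nf
  rcases mul_eq_zero.1 hx with h | h
  · obtain ⟨n, hn⟩ := (qProd_eq_zero_iff hp).1 h
    rw [hpow, sub_eq_zero, eq_comm, Complex.exp_eq_one_iff] at hn
    obtain ⟨k, hk⟩ := hn
    refine ⟨k, -(n + 1), ?_⟩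
    apply mul_left_cancel₀ (show (2 * I : ℂ) ≠ 0 by simp)
    push_cast
    linear_combination hk
  · obtain ⟨n, hn⟩ := (qProd_eq_zero_iff hp).1 h
    rw [hpow, sub_eq_zero, eq_comm, Complex.exp_eq_one_iff] at hn
    obtain ⟨k, hk⟩ := hn
    refine ⟨-k, n, ?_⟩
    apply mul_left_cancel₀ (show (2 * I : ℂ) ≠ 0 by simp)
    push_cast
    linear_combination -hk

lemma meromorphicOrderAt_mul_exp {F : ℂ → ℂ} {C k : ℂ} (hC : C ≠ 0) (x : ℂ) :
    meromorphicOrderAt (fun y => C * cexp (k * y) * F y) x = meromorphicOrderAt F x :=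
  meromorphicOrderAt_mul_of_ne_zero (g := fun y => C * cexp (k * y)) (by fun_prop)
    (mul_ne_zero hC (exp_ne_zero _))

lemma Function.Periodic.meromorphicOrderAt {F : ℂ → ℂ} {c : ℂ} (h : Function.Periodic F c) :
    Function.Periodic (meromorphicOrderAt F) c := by
  intro x
  rw [← meromorphicOrderAt_fun_comp_add_const_eq_meromorphicOrderAt, funext h]

/-- The order of a quasi-periodic function is periodic. -/
lemma periodic_meromorphicOrderAt_of_quasiperiodic {F : ℂ → ℂ} {c C k : ℂ} (hC : C ≠ 0)
    (h : ∀ x, F (x + c) = C * cexp (k * x) * F x) :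
    Function.Periodic (meromorphicOrderAt F) c := by
  intro x
  rw [← meromorphicOrderAt_fun_comp_add_const_eq_meromorphicOrderAt, funext h,
    meromorphicOrderAt_mul_exp hC]

lemma nome_ne_zero (ω : ℂ) : nome ω ≠ 0 := exp_ne_zero _

lemma neg_inv_nome_ne_zero (ω : ℂ) : -(nome ω)⁻¹ ≠ 0 := neg_ne_zero.2 (inv_ne_zero (nome_ne_zero ω))

/-- The first factor of the second product has a simple zero here. What remains is two products
evaluated at `q²`, whose factors `1 - q^{2n+2}` do not vanish since `|q| < 1`. -/
lemma meromorphicOrderAt_thetaProd_half_period (hω : 0 < ω.im) :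
    meromorphicOrderAt (thetaProd ω) (Real.pi * ω / 2) = 1 := by
  have hp := norm_nome_sq_lt_one hω
  have hd := differentiable_qProd hp
  have e : nome ω * cexp (-2 * I * (Real.pi * ω / 2)) = 1 := by
    rw [nome, ← Complex.exp_add]; ring_nf; simp
  have e' : nome ω * cexp (2 * I * (Real.pi * ω / 2)) = nome ω ^ 2 := by
    rw [nome, ← Complex.exp_add, ← Complex.exp_nat_mul]; push_cast; ring_nf
  have hone : ∀ n : ℕ, 1 - nome ω ^ 2 * (nome ω ^ 2) ^ n ≠ 0 := by
    intro n hn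
    rw [sub_eq_zero, ← pow_succ'] at hn
    have := congrArg norm hn
    rw [norm_one, norm_pow] at this
    exact (pow_lt_one₀ (norm_nonneg _) hp n.succ_ne_zero).ne' this
  have hR : Differentiable ℂ fun x => qProd (nome ω ^ 2) (nome ω * cexp (2 * I * x)) *
      qProd (nome ω ^ 2) (nome ω ^ 2 * (nome ω * cexp (-2 * I * x))) :=
    (hd.comp (f := fun x => nome ω * cexp (2 * I * x)) (by fun_prop)).mul
      (hd.comp (f := fun x => nome ω ^ 2 * (nome ω * cexp (-2 * I * x))) (by fun_prop))
  have hfac : thetaProd ω = (fun x => qProd (nome ω ^ 2) (nome ω * cexp (2 * I * x)) *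
      qProd (nome ω ^ 2) (nome ω ^ 2 * (nome ω * cexp (-2 * I * x)))) *
      fun x => 1 - nome ω * cexp (-2 * I * x) := by
    ext x
    rw [thetaProd, qProd_eq_mul hp (nome ω * cexp (-2 * I * x))]
    simp only [Pi.mul_apply]
    ring
  have hu : HasDerivAt (fun x => 1 - nome ω * cexp (-2 * I * x))
      (2 * I) (Real.pi * ω / 2) := by
    refine ((((hasDerivAt_id (Real.pi * ω / 2 : ℂ)).const_mul (-2 * I)).cexp.const_mul
      (nome ω)).const_sub 1).congr_deriv ?_
    simp only [id]
    linear_combination 2 * I * e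
  rw [hfac, meromorphicOrderAt_mul_of_ne_zero (hR.analyticAt _)]
  · have han : AnalyticAt ℂ (fun x => 1 - nome ω * cexp (-2 * I * x)) (Real.pi * ω / 2) := by
      fun_prop
    rw [han.meromorphicOrderAt_eq, han.analyticOrderAt_eq_one_of_zero_deriv_ne_zero]
    · rfl
    · rw [e, sub_self]
    · rw [hu.deriv]; simp
  · rw [e, e', mul_one]
    exact mul_ne_zero (qProd_ne_zero hp hone) (qProd_ne_zero hp hone)

lemma meromorphicOrderAt_thetaProd (hω : 0 < ω.im) (x : ℂ) :
    (InLattice ω (x - Real.pi * ω / 2) → meromorphicOrderAt (thetaProd ω) x = 1) ∧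
    (¬ InLattice ω (x - Real.pi * ω / 2) → meromorphicOrderAt (thetaProd ω) x = 0) := by
  refine ⟨fun h => ?_, fun h => ?_⟩
  · rw [h.eq_of_periodic (thetaProd_periodic ω).meromorphicOrderAt
      (periodic_meromorphicOrderAt_of_quasiperiodic (neg_inv_nome_ne_zero ω)
        (thetaProd_add_pi_mul hω)), meromorphicOrderAt_thetaProd_half_period hω]
  · have han := (differentiable_thetaProd hω).analyticAt x
    rw [han.meromorphicOrderAt_eq, han.analyticOrderAt_eq_zero.2
      fun h0 => h (inLattice_of_thetaProd_eq_zero hω h0)]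
    rfl

end thetaProd

/-! ### The Jacobi theta function and its product formula. -/

section ellipticTheta

variable {ω : ℂ}

lemma ellipticTheta_periodic (ω : ℂ) : Function.Periodic (ellipticTheta ω) (Real.pi : ℂ) := by
  intro x
  have hpi : (Real.pi : ℂ) ≠ 0 := by exact_mod_cast Real.pi_ne_zero
  rw [ellipticTheta, ellipticTheta, ← jacobiTheta₂_add_left (x / (Real.pi : ℂ) + 1 / 2)]
  congr 1
  field_simp
  ring

lemma ellipticTheta_neg (ω x : ℂ) : ellipticTheta ω (-x) = ellipticTheta ω x := by
  rw [ellipticTheta, ellipticTheta, ← jacobiTheta₂_neg_left (-x / (Real.pi : ℂ) + 1 / 2),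
    ← jacobiTheta₂_add_left (-(-x / (Real.pi : ℂ) + 1 / 2))]
  congr 1
  ring

lemma ellipticTheta_add_pi_mul (ω x : ℂ) :
    ellipticTheta ω (x + Real.pi * ω) =
      -(nome ω)⁻¹ * cexp (-2 * I * x) * ellipticTheta ω x := by
  have hpi : (Real.pi : ℂ) ≠ 0 := by exact_mod_cast Real.pi_ne_zero
  rw [ellipticTheta, ellipticTheta, show (x + Real.pi * ω) / (Real.pi : ℂ) + 1 / 2 =
    (x / (Real.pi : ℂ) + 1 / 2) + ω by field_simp; ring, jacobiTheta₂_add_left']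
  congr 1
  rw [nome, ← Complex.exp_neg, ← neg_one_mul (cexp _), ← Complex.exp_pi_mul_I, ← Complex.exp_add,
    ← Complex.exp_add, Complex.exp_eq_exp_iff_exists_int]
  -- The half-period in the argument of `jacobiTheta₂` contributes `e^{-πi}`, whereas the sign was
  -- written as `e^{πi}`; the exponents differ by `-2πi`.
  refine ⟨-1, ?_⟩
  push_cast
  field_simp
  ring

lemma differentiable_ellipticTheta (hω : 0 < ω.im) : Differentiable ℂ (ellipticTheta ω) := by
  intro x
  exact (differentiableAt_jacobiTheta₂_fst (x / (Real.pi : ℂ) + 1 / 2) hω).comp x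
    (f := fun x => x / (Real.pi : ℂ) + 1 / 2) (by fun_prop)

/-- Evenness and the shift from `-πω/2` to `πω/2`, whose multiplier is exactly `-1`, give `θ = -θ`
at this point. -/
lemma ellipticTheta_half_period (ω : ℂ) : ellipticTheta ω (Real.pi * ω / 2) = 0 := by
  have h := ellipticTheta_add_pi_mul ω (-(Real.pi * ω / 2))
  rw [ellipticTheta_neg, show -(Real.pi * ω / 2) + Real.pi * ω = Real.pi * ω / 2 by ring,
    show -2 * I * -(Real.pi * ω / 2) = Real.pi * I * ω by ring, ← nome,
    neg_mul, inv_mul_cancel₀ (nome_ne_zero ω), neg_one_mul, self_eq_neg] at h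
  exact h

/-- The constant Fourier coefficient of the theta function is `1`, so it does not vanish
identically. -/
lemma exists_jacobiTheta₂_ne_zero (hω : 0 < ω.im) : ∃ z, jacobiTheta₂ z ω ≠ 0 := by
  by_contra! h
  let f : ℤ → C(ℝ, ℂ) := fun n => ⟨fun t => jacobiTheta₂_term n t ω, by
    unfold jacobiTheta₂_term; fun_prop⟩
  have hs : Summable fun n : ℤ =>
      ‖(f n).restrict (⟨Set.uIcc 0 1, isCompact_uIcc⟩ : TopologicalSpace.Compacts ℝ)‖ := by
    have hb := summable_pow_mul_jacobiTheta₂_term_bound 0 hω 0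
    refine Summable.of_nonneg_of_le (fun _ => norm_nonneg _) (fun n => ?_) hb
    rw [pow_zero, one_mul, ContinuousMap.norm_le _ (Real.exp_pos _).le]
    rintro ⟨t, ht⟩
    exact norm_jacobiTheta₂_term_le hω (z := (t : ℂ)) (by simp) le_rfl n
  have key := intervalIntegral.hasSum_intervalIntegral_of_summable_norm hs
  have h0 : ∀ t : ℝ, ∑' n, f n t = 0 := fun t => h t
  simp only [h0, intervalIntegral.integral_zero] at key
  have hn : ∀ n : ℤ, n ≠ 0 → ∫ t in (0 : ℝ)..1, f n t = 0 := by
    intro n hn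
    have hc : (2 * Real.pi * I * n : ℂ) ≠ 0 := by
      simp [hn]
    have e : ∀ t : ℝ, f n t = cexp (Real.pi * I * n ^ 2 * ω) * cexp (2 * Real.pi * I * n * t) := by
      intro t
      rw [← Complex.exp_add, add_comm]
      rfl
    simp only [e]
    rw [intervalIntegral.integral_const_mul, integral_exp_mul_complex hc]
    have : cexp (2 * Real.pi * I * n * (1 : ℝ)) = 1 := by
      rw [Complex.exp_eq_one_iff]; exact ⟨n, by push_cast; ring⟩
    rw [this]
    simp
  have h1 : ∫ t in (0 : ℝ)..1, f 0 t = 1 := by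
    have e : ∀ t : ℝ, f 0 t = 1 := by
      intro t
      change jacobiTheta₂_term 0 t ω = 1
      simp [jacobiTheta₂_term]
    simp [e]
  have := key.unique (hasSum_single 0 fun n hn0 => hn n hn0)
  rw [h1] at this
  exact zero_ne_one this

/-- **Product formula for the theta function**, up to a constant. -/
lemma exists_thetaProd_eq_mul_ellipticTheta (hω : 0 < ω.im) :
    ∃ κ : ℂ, κ ≠ 0 ∧ ∀ x, thetaProd ω x = κ * ellipticTheta ω x := by
  have hθ := differentiable_ellipticTheta hω
  have hP := differentiable_thetaProd hω
  set F : ℂ → ℂ := fun x => ellipticTheta ω x / thetaProd ω x with hF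
  have hPn : ∀ x, ∀ᶠ y in 𝓝[≠] x, thetaProd ω y ≠ 0 := by
    intro x
    rw [← meromorphicOrderAt_ne_top_iff_eventually_ne_zero (hP.analyticAt x).meromorphicAt]
    have := meromorphicOrderAt_thetaProd hω x
    by_cases h : InLattice ω (x - Real.pi * ω / 2)
    · rw [this.1 h]; decide
    · rw [this.2 h]; decide
  have hm : Meromorphic F := fun x => (hθ.analyticAt x).meromorphicAt.div
    (hP.analyticAt x).meromorphicAt
  -- At a zero of the product, which is simple, `θ` has order at least `1` by periodicity of its
  -- order; elsewhere the denominator has order `0`.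
  have hord : ∀ x, 0 ≤ meromorphicOrderAt F x := by
    intro x
    have hFe : F = ellipticTheta ω * (thetaProd ω)⁻¹ := by
      ext y; simp [hF, div_eq_mul_inv]
    rw [hFe, meromorphicOrderAt_mul (hθ.analyticAt x).meromorphicAt
      (hP.analyticAt x).meromorphicAt.inv, meromorphicOrderAt_inv]
    have := meromorphicOrderAt_thetaProd hω x
    by_cases h : InLattice ω (x - Real.pi * ω / 2)
    · rw [this.1 h, h.eq_of_periodic (ellipticTheta_periodic ω).meromorphicOrderAt
        (periodic_meromorphicOrderAt_of_quasiperiodic (neg_inv_nome_ne_zero ω)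
          (ellipticTheta_add_pi_mul ω))]
      have han := hθ.analyticAt (Real.pi * ω / 2)
      have h1 : (1 : WithTop ℤ) ≤ meromorphicOrderAt (ellipticTheta ω) (Real.pi * ω / 2) := by
        rw [han.meromorphicOrderAt_eq]
        have := han.analyticOrderAt_ne_zero.2 (ellipticTheta_half_period ω)
        cases hn : analyticOrderAt (ellipticTheta ω) (Real.pi * ω / 2) with
        | top => simp
        | coe n =>
          rw [hn] at this
          have : n ≠ 0 := by simpa using this
          rw [ENat.map_natCast]
          exact WithTop.coe_le_coe.2 (by exact_mod_cast Nat.one_le_iff_ne_zero.2 this)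
      calc (0 : WithTop ℤ) = 1 + -1 := rfl
        _ ≤ _ := by gcongr
    · rw [this.2 h]
      simpa using (hθ.analyticAt x).meromorphicOrderAt_nonneg
  obtain ⟨h, hd, hhF, -⟩ := hm.exists_differentiable hord
  have h₁ : Function.Periodic h (Real.pi : ℂ) := fun x => by
    simpa using apply_add_eq_of_eventuallyEq_nhdsNE (u := fun _ => 1) (c := (Real.pi : ℂ))
      hd.continuous continuous_const hhF
      (fun x => .of_forall fun y => by
        simp only [hF, ellipticTheta_periodic ω y, thetaProd_periodic ω y, one_mul]) x
  have h₂ : Function.Periodic h (Real.pi * ω) := fun x => by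
    simpa using apply_add_eq_of_eventuallyEq_nhdsNE (u := fun _ => 1) (c := (Real.pi * ω : ℂ))
      hd.continuous continuous_const hhF
      (fun x => .of_forall fun y => by
        simp only [hF, ellipticTheta_add_pi_mul ω y, thetaProd_add_pi_mul hω y, one_mul]
        exact mul_div_mul_left _ _ (mul_ne_zero (neg_inv_nome_ne_zero ω) (exp_ne_zero _))) x
  obtain ⟨c, hc⟩ := hd.eq_const_of_periodic hω h₁ h₂
  have hθP : ∀ x, ellipticTheta ω x = c * thetaProd ω x := by
    intro x
    refine ContinuousAt.eq_of_eventuallyEq_nhdsNE (hθ x).continuousAt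
      (g := fun x => c * thetaProd ω x) ((hP x).continuousAt.const_mul c) ?_
    filter_upwards [hhF x, hPn x] with y h1 h2
    rw [← hc y, h1, hF]
    field_simp
  have hc0 : c ≠ 0 := by
    rintro rfl
    obtain ⟨z, hz⟩ := exists_jacobiTheta₂_ne_zero hω
    have hpi : (Real.pi : ℂ) ≠ 0 := by exact_mod_cast Real.pi_ne_zero
    apply hz
    have := hθP (Real.pi * (z - 1 / 2))
    rw [ellipticTheta, zero_mul] at this
    rw [← this]
    congr 1
    field_simp
    ring
  exact ⟨c⁻¹, inv_ne_zero hc0, fun x => by rw [hθP x, inv_mul_cancel_left₀ hc0]⟩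

lemma meromorphicOrderAt_ellipticTheta (hω : 0 < ω.im) (x : ℂ) :
    (InLattice ω (x - Real.pi * ω / 2) → meromorphicOrderAt (ellipticTheta ω) x = 1) ∧
    (¬ InLattice ω (x - Real.pi * ω / 2) → meromorphicOrderAt (ellipticTheta ω) x = 0) := by
  obtain ⟨κ, hκ, h⟩ := exists_thetaProd_eq_mul_ellipticTheta hω
  have : meromorphicOrderAt (ellipticTheta ω) x = meromorphicOrderAt (thetaProd ω) x := by
    rw [funext h, ← meromorphicOrderAt_mul_exp (C := κ) (k := 0) hκ]
    simp
  rw [this]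
  exact meromorphicOrderAt_thetaProd hω x

lemma ellipticTheta_eq_zero_iff (hω : 0 < ω.im) {x : ℂ} :
    ellipticTheta ω x = 0 ↔ InLattice ω (x - Real.pi * ω / 2) := by
  obtain ⟨κ, hκ, h⟩ := exists_thetaProd_eq_mul_ellipticTheta hω
  refine ⟨fun h0 => inLattice_of_thetaProd_eq_zero hω (by rw [h, h0, mul_zero]), fun hx => ?_⟩
  by_contra h0
  have han := (differentiable_ellipticTheta hω).analyticAt x
  have h1 := (meromorphicOrderAt_ellipticTheta hω x).1 hx
  rw [han.meromorphicOrderAt_eq, han.analyticOrderAt_eq_zero.2 h0] at h1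
  exact absurd h1 (by decide)

/-- Translation of the theta function by multiples of the second period. -/
lemma exists_ellipticTheta_add_int_mul (ω : ℂ) (n : ℤ) :
    ∃ C : ℂ, C ≠ 0 ∧ ∀ x, ellipticTheta ω (x + n * (Real.pi * ω)) =
      C * cexp (-2 * I * n * x) * ellipticTheta ω x := by
  induction n using Int.induction_on with
  | zero => exact ⟨1, one_ne_zero, by simp⟩
  | succ n ih =>
    obtain ⟨C, hC, h⟩ := ih
    refine ⟨C * -(nome ω)⁻¹ * cexp (-2 * I * (n * (Real.pi * ω))),
      mul_ne_zero (mul_ne_zero hC (neg_inv_nome_ne_zero ω)) (exp_ne_zero _), fun x => ?_⟩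
    push_cast at h ⊢
    rw [show x + (n + 1) * (Real.pi * ω) = (x + n * (Real.pi * ω)) + Real.pi * ω by ring,
      ellipticTheta_add_pi_mul, h,
      show -2 * I * (x + n * (Real.pi * ω)) = -2 * I * x + -2 * I * (n * (Real.pi * ω)) by ring,
      show -2 * I * (n + 1) * x = -2 * I * x + -2 * I * n * x by ring, Complex.exp_add,
      Complex.exp_add]
    ring
  | pred n ih =>
    obtain ⟨C, hC, h⟩ := ih
    refine ⟨C * -nome ω * cexp (2 * I * ((-n - 1) * (Real.pi * ω))),
      mul_ne_zero (mul_ne_zero hC (neg_ne_zero.2 (nome_ne_zero ω))) (exp_ne_zero _), fun x => ?_⟩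
    have h' := ellipticTheta_add_pi_mul ω (x + (-n - 1) * (Real.pi * ω))
    push_cast at h ⊢
    rw [show x + (-n - 1) * (Real.pi * ω) + Real.pi * ω = x + -n * (Real.pi * ω) by ring, h] at h'
    have e : cexp (2 * I * ((-n - 1) * (Real.pi * ω))) * cexp (-2 * I * (-n - 1) * x) *
        (cexp (-2 * I * (x + (-n - 1) * (Real.pi * ω)))) = cexp (-2 * I * -n * x) := by
      rw [← Complex.exp_add, ← Complex.exp_add]; ring_nf
    have e2 := exp_ne_zero (-2 * I * (x + (-n - 1) * (Real.pi * ω)))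
    have hq := nome_ne_zero ω
    apply mul_left_cancel₀ (mul_ne_zero (neg_inv_nome_ne_zero ω) e2)
    rw [← h', ← e]
    field_simp

end ellipticTheta

/-! ### Factorization of elliptic functions. -/

section factorization

lemma Finset.exists_fin_prod_pow (s : Finset ℂ) (e : ℂ → ℕ) :
    ∃ (n : ℕ) (a : Fin n → ℂ), (∀ j, a j ∈ s ∧ e (a j) ≠ 0) ∧
      ∀ g : ℂ → ℂ, ∏ z ∈ s, g z ^ e z = ∏ j, g (a j) := by
  let φ := Fintype.equivFin (Σ z : s, Fin (e z))
  refine ⟨_, fun j => ((φ.symm j).1 : ℂ), fun j => ⟨(φ.symm j).1.2, fun h => ?_⟩, fun g => ?_⟩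
  · exact (h ▸ (φ.symm j).2).elim0
  · rw [Equiv.prod_comp φ.symm (fun i : Σ z : s, Fin (e z) => g (i.1 : ℂ)), Fintype.prod_sigma]
    simp only [Finset.prod_const, Finset.card_univ, Fintype.card_fin]
    exact (Finset.prod_coe_sort s fun z => g z ^ e z).symm

/-- Lists zeros and poles with multiplicity. Only the negativity at the `b j` is kept: it later
shows that the denominators do not vanish where `f` is analytic. -/
lemma Finset.exists_fin_prod_zpow (s : Finset ℂ) (D : ℂ → ℤ) :
    ∃ (n m : ℕ) (a : Fin n → ℂ) (b : Fin m → ℂ), (∀ j, D (b j) < 0) ∧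
      ∀ g : ℂ → ℂ, ∏ z ∈ s, g z ^ D z = (∏ j, g (a j)) / ∏ j, g (b j) := by
  obtain ⟨n, a, -, ha⟩ := s.exists_fin_prod_pow fun z => (D z).toNat
  obtain ⟨m, b, hb, hb'⟩ := s.exists_fin_prod_pow fun z => (-D z).toNat
  refine ⟨n, m, a, b, fun j => ?_, fun g => ?_⟩
  · have := (hb j).2
    omega
  · rw [← ha, ← hb', ← Finset.prod_div_distrib]
    refine Finset.prod_congr rfl fun z _ => ?_
    rcases le_total 0 (D z) with h | h
    · rw [Int.toNat_of_nonpos (neg_nonpos.2 h), pow_zero, div_one, ← zpow_natCast,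
        Int.toNat_of_nonneg h]
    · rw [Int.toNat_of_nonpos h, pow_zero, one_div, ← zpow_natCast,
        Int.toNat_of_nonneg (neg_nonneg.2 h), zpow_neg, inv_inv]

variable {ω : ℂ}

/-- The multiplier records both the number of the `a j`, in the exponent of `x`, and their sum, in
the constant. -/
lemma prod_ellipticTheta_add_pi_mul (ω : ℂ) {n : ℕ} (a : Fin n → ℂ) (x : ℂ) :
    ∏ j, ellipticTheta ω (x + Real.pi * ω - a j) =
      (-(nome ω)⁻¹) ^ n * cexp (2 * I * ∑ j, a j) * cexp (-2 * I * n * x) *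
        ∏ j, ellipticTheta ω (x - a j) := by
  have h : ∀ j, ellipticTheta ω (x + Real.pi * ω - a j) =
      -(nome ω)⁻¹ * (cexp (2 * I * a j) * cexp (-2 * I * x)) * ellipticTheta ω (x - a j) := by
    intro j
    rw [show x + Real.pi * ω - a j = x - a j + Real.pi * ω by ring, ellipticTheta_add_pi_mul,
      ← Complex.exp_add]
    ring_nf
  simp only [h, Finset.prod_mul_distrib, Finset.prod_const, Finset.card_univ, Fintype.card_fin,
    ← Complex.exp_sum, ← Finset.mul_sum, ← Complex.exp_nat_mul]
  ring_nf

/-- The order of a product of powers of theta functions with zeros at incongruent points. -/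
lemma meromorphicOrderAt_prod_ellipticTheta_zpow (hω : 0 < ω.im) {s : Finset ℂ} {D : ℂ → ℤ}
    (hs : ∀ z, z ∈ s ↔ z ∈ fundamentalCell ω ∧ D z ≠ 0)
    (hD : ∀ z w, InLattice ω (z - w) → D z = D w) (x : ℂ) :
    meromorphicOrderAt (fun x => ∏ z ∈ s, ellipticTheta ω (x - (z - Real.pi * ω / 2)) ^ D z) x =
      (D x : WithTop ℤ) := by
  classical
  have hθ : ∀ c : ℂ, Differentiable ℂ fun x => ellipticTheta ω (x - c) := fun c =>
    (differentiable_ellipticTheta hω).comp (by fun_prop)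
  have hm : ∀ c : ℂ, MeromorphicAt (fun x => ellipticTheta ω (x - c)) x := fun c =>
    ((hθ c).analyticAt x).meromorphicAt
  rw [meromorphicOrderAt_fun_prod fun z _ => (hm _).fun_zpow _]
  have h : ∀ z, meromorphicOrderAt
      (fun x => ellipticTheta ω (x - (z - Real.pi * ω / 2)) ^ D z) x =
      ((if InLattice ω (x - z) then D z else 0 : ℤ) : WithTop ℤ) := by
    intro z
    rw [fun_meromorphicOrderAt_zpow (hm _),
      meromorphicOrderAt_fun_comp_sub_const_eq_meromorphicOrderAt]
    have := meromorphicOrderAt_ellipticTheta hω (x - (z - Real.pi * ω / 2))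
    rw [show x - (z - Real.pi * ω / 2) - Real.pi * ω / 2 = x - z by ring] at this
    split_ifs with hl
    · rw [this.1 hl, mul_one]
    · rw [this.2 hl, mul_zero]; rfl
  simp only [h]
  -- Points of the cell are pairwise incongruent, so only the representative `r` of `x` can
  -- contribute to the order.
  obtain ⟨r, hr, hxr⟩ := exists_mem_fundamentalCell hω x
  have hne : ∀ z ∈ s, z ≠ r → (if InLattice ω (x - z) then D z else 0 : ℤ) = 0 := by
    intro z hz hzr
    rw [if_neg]
    exact fun hl => hzr (eq_of_mem_fundamentalCell hω ((hs z).1 hz).1 hr (hl.symm.trans hxr))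
  rw [← WithTop.coe_sum, Finset.sum_eq_single r hne, if_pos hxr, hD x r hxr]
  intro hrs
  rw [if_pos hxr]
  by_contra h0
  exact hrs ((hs r).2 ⟨hr, h0⟩)

/-- An exponential factor that restores periodicity is absorbed by moving a zero. -/
lemma exists_shift_prod_ellipticTheta (hω : 0 < ω.im) {n : ℕ} (a b : Fin n → ℂ) {c : ℂ}
    (hc : c ≠ 0) (l : ℤ)
    (hl : cexp (2 * I * l * (Real.pi * ω)) * cexp (2 * I * ∑ j, a j) =
      cexp (2 * I * ∑ j, b j)) :
    ∃ (a' : Fin n → ℂ) (c' : ℂ), c' ≠ 0 ∧ ∑ j, a' j = ∑ j, b j ∧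
      ∀ x, c * cexp (2 * I * l * x) * ∏ j, ellipticTheta ω (x - a j) =
        c' * ∏ j, ellipticTheta ω (x - a' j) := by
  have hpi := Real.pi_ne_zero
  rw [← Complex.exp_add, Complex.exp_eq_exp_iff_exists_int] at hl
  obtain ⟨k, hk⟩ := hl
  have hk' : ∑ j, a j - ∑ j, b j = k * Real.pi - l * (Real.pi * ω) := by
    apply mul_left_cancel₀ (show (2 * I : ℂ) ≠ 0 by simp)
    linear_combination hk
  -- With no zero to move, both sums are empty; then `kπ = lπω`, and the imaginary part gives `l =
  -- 0`.
  rcases n with _ | n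
  · have him : (l : ℝ) * (Real.pi * ω.im) = 0 := by simpa using congrArg im hk'
    have hl0 : l = 0 := by
      rcases mul_eq_zero.1 him with h | h
      · exact_mod_cast h
      · exact absurd h (mul_ne_zero hpi hω.ne')
    exact ⟨a, c, hc, by simp, by simp [hl0]⟩
  · obtain ⟨C, hC, h⟩ := exists_ellipticTheta_add_int_mul ω (-l)
    -- The first zero moves by the lattice vector `kπ - lπω`, the difference of the sums. The
    -- multiplier of this shift supplies `e^{2il(x - a 0)}`, and the rest goes into `c'`.
    refine ⟨Fin.cons (a 0 - (∑ j, a j - ∑ j, b j)) fun j => a j.succ,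
      c * C⁻¹ * cexp (2 * I * l * a 0),
      mul_ne_zero (mul_ne_zero hc (inv_ne_zero hC)) (exp_ne_zero _), ?_, fun x => ?_⟩
    · rw [Fin.sum_univ_succ]
      simp only [Fin.cons_zero, Fin.cons_succ]
      rw [Fin.sum_univ_succ a]
      ring
    · rw [Fin.prod_univ_succ, Fin.prod_univ_succ]
      simp only [Fin.cons_zero, Fin.cons_succ]
      have h' := h (x - a 0)
      rw [← (ellipticTheta_periodic ω).int_mul k, show x - a 0 + (-l : ℤ) * (Real.pi * ω) +
        k * Real.pi = x - (a 0 - (∑ j, a j - ∑ j, b j)) by rw [hk']; push_cast; ring] at h'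
      rw [h', show 2 * I * l * x = 2 * I * l * a 0 + -2 * I * (-l : ℤ) * (x - a 0) by
        push_cast; ring, Complex.exp_add]
      field_simp

/-- **Factorization of elliptic functions** as quotients of theta functions. -/
theorem exists_eq_prod_ellipticTheta (hω : 0 < ω.im) {f : ℂ → ℂ} (hf : Meromorphic f)
    (h₁ : Function.Periodic f (Real.pi : ℂ)) (h₂ : Function.Periodic f (Real.pi * ω))
    (hne : ∃ x, AnalyticAt ℂ f x ∧ f x ≠ 0) :
    ∃ (m : ℕ) (a b : Fin m → ℂ) (c : ℂ), c ≠ 0 ∧ ∑ j, a j = ∑ j, b j ∧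
      ∀ x : ℂ, AnalyticAt ℂ f x → (∀ j, ellipticTheta ω (x - b j) ≠ 0) ∧
        f x = c * ∏ j, (ellipticTheta ω (x - a j) / ellipticTheta ω (x - b j)) := by
  classical
  have hfin : ∀ x, meromorphicOrderAt f x ≠ ⊤ := by
    obtain ⟨x₀, ha, h0⟩ := hne
    intro x
    refine MeromorphicOn.meromorphicOrderAt_ne_top_of_isPreconnected (U := Set.univ)
      (fun x _ => hf x) isPreconnected_univ (Set.mem_univ x₀) (Set.mem_univ x) ?_
    rw [ha.meromorphicOrderAt_eq, ha.analyticOrderAt_eq_zero.2 h0]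
    decide
  set D : ℂ → ℤ := fun x => (meromorphicOrderAt f x).untop₀ with hDdef
  have hDo : ∀ x, meromorphicOrderAt f x = (D x : WithTop ℤ) := fun x =>
    (WithTop.coe_untop₀_of_ne_top (hfin x)).symm
  have hD : ∀ z w, InLattice ω (z - w) → D z = D w := by
    intro z w h
    simp only [hDdef]
    rw [h.eq_of_periodic h₁.meromorphicOrderAt h₂.meromorphicOrderAt]
  obtain ⟨s, hs⟩ : ∃ s : Finset ℂ, ∀ z, z ∈ s ↔ z ∈ fundamentalCell ω ∧ D z ≠ 0 := by
    obtain ⟨K, hK, hsub⟩ := exists_isCompact_fundamentalCell_subset ω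
    have hfK : MeromorphicOn f K := fun x _ => hf x
    have hfinite : {z | z ∈ fundamentalCell ω ∧ D z ≠ 0}.Finite := by
      refine ((MeromorphicOn.divisor f K).finiteSupport hK).subset fun z hz => ?_
      rw [Function.mem_support, MeromorphicOn.divisor_apply hfK (hsub hz.1)]
      exact hz.2
    exact ⟨hfinite.toFinset, fun z => by simp⟩
  obtain ⟨n, m, a, b, hb, hprod⟩ := s.exists_fin_prod_zpow D
  -- The shift by `πω/2` places the zero of each theta function at `z` itself.
  set G : ℂ → ℂ := fun x => ∏ z ∈ s, ellipticTheta ω (x - (z - Real.pi * ω / 2)) ^ D z with hGdef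
  have hGo : ∀ x, meromorphicOrderAt G x = (D x : WithTop ℤ) :=
    meromorphicOrderAt_prod_ellipticTheta_zpow hω hs hD
  have hθ : ∀ c : ℂ, Differentiable ℂ fun x => ellipticTheta ω (x - c) := fun c =>
    (differentiable_ellipticTheta hω).comp (by fun_prop)
  have hGm : Meromorphic G := fun x => MeromorphicAt.fun_prod fun z _ =>
    (((hθ _).analyticAt x).meromorphicAt).fun_zpow _
  have hG0 : ∀ x, ∀ᶠ y in 𝓝[≠] x, G y ≠ 0 := fun x => by
    rw [← meromorphicOrderAt_ne_top_iff_eventually_ne_zero (hGm x), hGo x]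
    exact WithTop.coe_ne_top
  have hbzero : ∀ x, AnalyticAt ℂ f x →
      ∀ j, ellipticTheta ω (x - (b j - Real.pi * ω / 2)) ≠ 0 := by
    intro x hx j h0
    rw [ellipticTheta_eq_zero_iff hω,
      show x - (b j - Real.pi * ω / 2) - Real.pi * ω / 2 = x - b j by ring] at h0
    have h1 := hx.meromorphicOrderAt_nonneg
    rw [hDo, hD _ _ h0] at h1
    exact absurd (hb j) (not_lt.2 (by exact_mod_cast h1))
  set a' : Fin n → ℂ := fun j => a j - Real.pi * ω / 2 with ha'
  set b' : Fin m → ℂ := fun j => b j - Real.pi * ω / 2 with hb'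
  have hGab : ∀ x, G x = (∏ j, ellipticTheta ω (x - a' j)) / ∏ j, ellipticTheta ω (x - b' j) :=
    fun x => hprod fun z => ellipticTheta ω (x - (z - Real.pi * ω / 2))
  have hFo : ∀ x, meromorphicOrderAt (fun x => f x / G x) x = 0 := fun x => by
    rw [fun_meromorphicOrderAt_div (hf x) (hGm x), hDo, hGo]
    exact LinearOrderedAddCommGroupWithTop.sub_self_eq_zero_of_ne_top WithTop.coe_ne_top
  obtain ⟨h, hd, hhF, hh0⟩ := Meromorphic.exists_differentiable
    (F := fun x => f x / G x) (fun x => (hf x).fun_div (hGm x)) (fun x => (hFo x).ge)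
  have hh0 : ∀ x, h x ≠ 0 := fun x => hh0 x (hFo x)
  have hper₁ : Function.Periodic h (Real.pi : ℂ) := fun x => by
    simpa using apply_add_eq_of_eventuallyEq_nhdsNE (u := fun _ => 1) (c := (Real.pi : ℂ))
      hd.continuous continuous_const hhF
      (fun x => .of_forall fun y => by
        have : ∀ c : ℂ, ellipticTheta ω (y + Real.pi - c) = ellipticTheta ω (y - c) := fun c => by
          rw [← ellipticTheta_periodic ω (y - c)]; ring_nf
        simp only [h₁ y, hGdef, this, one_mul]) x
  set N := -(nome ω)⁻¹ with hN
  have hN0 : N ≠ 0 := neg_inv_nome_ne_zero ω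
  have hper₂ : ∀ x, h (x + Real.pi * ω) =
      (N ^ m / N ^ n * cexp (2 * I * ∑ j, b' j - 2 * I * ∑ j, a' j)) *
        cexp ((2 * I * n - 2 * I * m) * x) * h x := by
    refine apply_add_eq_of_eventuallyEq_nhdsNE hd.continuous (by fun_prop) hhF
      fun x => .of_forall fun y => ?_
    have eA := prod_ellipticTheta_add_pi_mul ω a' y
    have eB := prod_ellipticTheta_add_pi_mul ω b' y
    rw [← hN] at eA eB
    rw [h₂ y, hGab, hGab, eA, eB, Complex.exp_sub, sub_mul, Complex.exp_sub,
      show -2 * I * n * y = -(2 * I * n * y) by ring,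
      show -2 * I * m * y = -(2 * I * m * y) by ring, Complex.exp_neg, Complex.exp_neg]
    simp only [div_eq_mul_inv, mul_inv, inv_inv]
    ring
  obtain ⟨hnm, c, l, hc, hh⟩ := exists_eq_exp_of_quasiperiodic hω hd hh0 hper₁ hper₂
  -- The vanishing exponent `k` says that zeros and poles are equally many.
  obtain rfl : n = m := by
    have : (2 * I : ℂ) * (n - m) = 0 := by linear_combination hnm
    have : (n : ℂ) = m := by simpa [sub_eq_zero] using this
    exact_mod_cast this
  have hl : cexp (2 * I * l * (Real.pi * ω)) * cexp (2 * I * ∑ j, a' j) =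
      cexp (2 * I * ∑ j, b' j) := by
    have := hper₂ 0
    rw [hh, hh] at this
    simp only [zero_add, mul_zero, Complex.exp_zero, mul_one, div_self (pow_ne_zero n hN0),
      one_mul, Complex.exp_sub] at this
    have h2 := exp_ne_zero (2 * I * ∑ j, a' j)
    field_simp at this
    rw [← this]
    ring_nf
  obtain ⟨a'', c', hc', hsum, heq⟩ := exists_shift_prod_ellipticTheta hω a' b' hc l hl
  refine ⟨n, a'', b', c', hc', hsum, fun x hx => ⟨hbzero x hx, ?_⟩⟩
  rw [Finset.prod_div_distrib, ← mul_div_assoc, ← heq x]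
  -- `h = f / G` is known only on punctured neighbourhoods, since `G` may vanish at `x`; continuity
  -- recovers the value of `f` there.
  refine ContinuousAt.eq_of_eventuallyEq_nhdsNE hx.continuousAt
    (g := fun x => c * cexp (2 * I * l * x) * (∏ j, ellipticTheta ω (x - a' j)) /
      ∏ j, ellipticTheta ω (x - b' j)) ?_ ?_
  · have hcA : ∀ {k : ℕ} (d : Fin k → ℂ), Continuous fun x => ∏ j, ellipticTheta ω (x - d j) :=
      fun d => continuous_finsetProd _ fun j _ => (hθ (d j)).continuous
    refine ContinuousAt.div₀ (ContinuousAt.mul (by fun_prop) (hcA a').continuousAt)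
      (hcA b').continuousAt ?_
    exact Finset.prod_ne_zero_iff.2 fun j _ => hbzero x hx j
  · filter_upwards [hhF x, hG0 x] with y h1 h2
    rw [mul_div_assoc, ← hGab y, ← hh y, h1, div_mul_cancel₀ _ h2]

end factorization

/-! ### Diagonal periodic linear systems and their block sums. -/

/-- The eigenvalues `i, -i` of a block of `A`. -/
noncomputable def blockEigenvalue : Fin 2 → ℂ := ![I, -I]

lemma norm_blockEigenvalue (i : Fin 2) : ‖blockEigenvalue i‖ = 1 := by
  fin_cases i <;> simp [blockEigenvalue]

/-- The diagonal `2 × 2` periodic linear system with `A = diag(i, -i)`, `B = I` and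
`E = diag(e)`. -/
noncomputable def diagonalSystem (e : Fin 2 → ℂ) (σ : ℂ) (hσ : σ = 1 ∨ σ = -1) :
    PeriodicLinearSystem (Fin 2) where
  A := Matrix.diagonal blockEigenvalue
  B := 1
  -- With `B = I` the relation `BC = ε(AE + EA)` forces `C = 2εAE`.
  C := Matrix.diagonal fun i => 2 * σ * (blockEigenvalue i * e i)
  E := Matrix.diagonal e
  ε := σ
  sign := hσ
  mul_BC := by
    rw [one_mul, Matrix.diagonal_mul_diagonal, Matrix.diagonal_mul_diagonal, Matrix.diagonal_add,
      ← Matrix.diagonal_smul]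
    congr 1
    ext i
    simp only [Pi.smul_apply, smul_eq_mul]
    ring
  comm_BE := by rw [one_mul, mul_one]
  comm_EA := by
    rw [Matrix.diagonal_mul_diagonal, Matrix.diagonal_mul_diagonal]
    simp only [mul_comm]
  exp_A := by
    rw [← Matrix.diagonal_smul, Matrix.exp_diagonal, ← Matrix.diagonal_one]
    congr 1
    ext i
    rw [Pi.coe_exp, ← Complex.exp_eq_exp_ℂ]
    fin_cases i
    · simp [blockEigenvalue, Complex.exp_two_pi_mul_I]
    · simp [blockEigenvalue, Complex.exp_neg, Complex.exp_two_pi_mul_I]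

section diagonalSystem

variable (e : Fin 2 → ℂ) (σ : ℂ) (hσ : σ = 1 ∨ σ = -1) (x : ℂ)

lemma diagonalSystem_expA : (diagonalSystem e σ hσ).expA x =
    Matrix.diagonal fun i => cexp (-x * blockEigenvalue i) := by
  rw [PeriodicLinearSystem.expA, diagonalSystem, ← Matrix.diagonal_smul, Matrix.exp_diagonal]
  congr 1
  ext i
  rw [Pi.coe_exp, ← Complex.exp_eq_exp_ℂ]
  simp

lemma diagonalSystem_pencil : (diagonalSystem e σ hσ).pencil x =
    Matrix.diagonal fun i => 1 - e i * cexp (-2 * blockEigenvalue i * x) := by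
  rw [PeriodicLinearSystem.pencil, diagonalSystem_expA, diagonalSystem,
    Matrix.diagonal_mul_diagonal, Matrix.diagonal_mul_diagonal, ← Matrix.diagonal_one,
    Matrix.diagonal_sub]
  congr 1
  ext i
  rw [show -2 * blockEigenvalue i * x = -x * blockEigenvalue i + -x * blockEigenvalue i by ring,
    Complex.exp_add]
  ring

lemma diagonalSystem_det_pencil : ((diagonalSystem e σ hσ).pencil x).det =
    ∏ i, (1 - e i * cexp (-2 * blockEigenvalue i * x)) := by
  rw [diagonalSystem_pencil, Matrix.det_diagonal]

variable {e x}

lemma diagonalSystem_isUnit_pencil (h : ∀ i, 1 - e i * cexp (-2 * blockEigenvalue i * x) ≠ 0) :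
    IsUnit ((diagonalSystem e σ hσ).pencil x) := by
  rw [Matrix.isUnit_iff_isUnit_det, diagonalSystem_det_pencil, isUnit_iff_ne_zero]
  exact Finset.prod_ne_zero_iff.2 fun i _ => h i

/-- With `u = e i · e^{-2λx}` and `λ` the eigenvalue, `u' = -2λu`, so each diagonal entry is `σ`
times the logarithmic derivative of the entry `1 - u` of the pencil. -/
lemma diagonalSystem_W (h : ∀ i, 1 - e i * cexp (-2 * blockEigenvalue i * x) ≠ 0) :
    (diagonalSystem e σ hσ).W x x = Matrix.diagonal fun i =>
      2 * σ * blockEigenvalue i * (e i * cexp (-2 * blockEigenvalue i * x) /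
        (1 - e i * cexp (-2 * blockEigenvalue i * x))) := by
  have hinv : ((diagonalSystem e σ hσ).pencil x)⁻¹ =
      Matrix.diagonal fun i => (1 - e i * cexp (-2 * blockEigenvalue i * x))⁻¹ := by
    refine Matrix.inv_eq_right_inv ?_
    rw [diagonalSystem_pencil, Matrix.diagonal_mul_diagonal, ← Matrix.diagonal_one]
    congr 1
    ext i
    exact mul_inv_cancel₀ (h i)
  rw [PeriodicLinearSystem.W, hinv, diagonalSystem_expA]
  simp only [diagonalSystem, Matrix.diagonal_mul_diagonal, mul_one]
  congr 1
  ext i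
  rw [show cexp (-2 * blockEigenvalue i * x) =
    cexp (-x * blockEigenvalue i) * cexp (-x * blockEigenvalue i) by
      rw [← Complex.exp_add]; ring_nf]
  rw [div_eq_mul_inv]
  ring

end diagonalSystem

lemma summable_norm_diagonal {κ : Type*} [DecidableEq κ] {d : κ → ℂ} (h : Summable fun k => ‖d k‖) :
    Summable fun p : κ × κ => ‖Matrix.diagonal d p.1 p.2‖ := by
  have hinj : Function.Injective fun k : κ => (k, k) := fun a b h => (Prod.mk.inj h).1
  refine (hinj.summable_iff ?_).1 (h.congr fun k => by simp)
  rintro ⟨a, b⟩ hab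
  have hne : a ≠ b := fun h => hab ⟨a, by rw [h]⟩
  rw [Matrix.diagonal_apply_ne _ hne, norm_zero]

lemma norm_diagonal_le {κ : Type*} [DecidableEq κ] {d : κ → ℂ} {K : ℝ} (hK : 0 ≤ K)
    (h : ∀ k, ‖d k‖ ≤ K) (i j : κ) : ‖Matrix.diagonal d i j‖ ≤ K := by
  rw [Matrix.diagonal_apply]
  split_ifs
  · exact h i
  · simpa using hK

lemma norm_sign {σ : ℂ} (hσ : σ = 1 ∨ σ = -1) : ‖σ‖ = 1 := by
  rcases hσ with rfl | rfl <;> simp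

/-- The block diagonal system with diagonal blocks. -/
noncomputable def blockSystem (e : Fin 2 × ℕ → ℂ) (he : Summable fun p => ‖e p‖) (σ : ℕ → ℂ)
    (hσ : ∀ n, σ n = 1 ∨ σ n = -1) : BlockPeriodicLinearSystem where
  block n := diagonalSystem (fun i => e (i, n)) (σ n) (hσ n)
  bounded_A := ⟨1, fun i j => by
    simp only [diagonalSystem, Matrix.blockDiagonal_diagonal]
    exact norm_diagonal_le zero_le_one (fun k => (norm_blockEigenvalue _).le) i j⟩
  bounded_B := ⟨1, fun i j => by
    simp only [diagonalSystem, ← Matrix.diagonal_one, Matrix.blockDiagonal_diagonal]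
    exact norm_diagonal_le zero_le_one (fun k => by simp) i j⟩
  bounded_C := ⟨2 * ∑' p, ‖e p‖, fun i j => by
    simp only [diagonalSystem, Matrix.blockDiagonal_diagonal]
    refine norm_diagonal_le (by positivity) (fun k => ?_) i j
    simp only [norm_mul, norm_sign (hσ _), norm_blockEigenvalue, Prod.mk.eta, RCLike.norm_ofNat,
      mul_one, one_mul]
    gcongr
    exact he.le_tsum k fun _ _ => norm_nonneg _⟩
  summable_E := by
    simp only [diagonalSystem, Matrix.blockDiagonal_diagonal, Prod.mk.eta]
    exact summable_norm_diagonal he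

section blockSystem

variable {e : Fin 2 × ℕ → ℂ} (he : Summable fun p => ‖e p‖) {σ : ℕ → ℂ}
  (hσ : ∀ n, σ n = 1 ∨ σ n = -1)

lemma norm_exp_le (x : ℂ) (i : Fin 2) :
    ‖cexp (-2 * blockEigenvalue i * x)‖ ≤ Real.exp (2 * ‖x‖) := by
  refine (Complex.norm_exp_le_exp_norm _).trans (Real.exp_le_exp.2 ?_)
  simp [norm_blockEigenvalue]

lemma blockSystem_regular {x : ℂ} (h : ∀ p, 1 - e p * cexp (-2 * blockEigenvalue p.1 * x) ≠ 0) :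
    (blockSystem e he σ hσ).Regular x := fun n =>
  diagonalSystem_isUnit_pencil _ _ fun i => h (i, n)

lemma blockSystem_hasTrace {x t : ℂ}
    (h : ∀ p, 1 - e p * cexp (-2 * blockEigenvalue p.1 * x) ≠ 0)
    (ht : HasSum (fun p : Fin 2 × ℕ => 2 * σ p.2 * blockEigenvalue p.1 *
      (e p * cexp (-2 * blockEigenvalue p.1 * x) /
        (1 - e p * cexp (-2 * blockEigenvalue p.1 * x)))) t) :
    ((blockSystem e he σ hσ).W x x).HasTrace t := by
  have hW : (blockSystem e he σ hσ).W x x = Matrix.diagonal fun p : Fin 2 × ℕ =>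
      2 * σ p.2 * blockEigenvalue p.1 * (e p * cexp (-2 * blockEigenvalue p.1 * x) /
        (1 - e p * cexp (-2 * blockEigenvalue p.1 * x))) := by
    rw [BlockPeriodicLinearSystem.W]
    simp only [blockSystem]
    rw [show (fun n => (diagonalSystem (fun i => e (i, n)) (σ n) (hσ n)).W x x) = fun n =>
      Matrix.diagonal fun i => 2 * σ n * blockEigenvalue i *
        (e (i, n) * cexp (-2 * blockEigenvalue i * x) /
          (1 - e (i, n) * cexp (-2 * blockEigenvalue i * x))) from
        funext fun n => diagonalSystem_W _ _ fun i => h (i, n), Matrix.blockDiagonal_diagonal]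
  rw [hW, Matrix.HasTrace]
  refine ⟨summable_norm_diagonal ?_, by simpa using ht⟩
  have hu : Summable fun p : Fin 2 × ℕ => ‖e p * cexp (-2 * blockEigenvalue p.1 * x)‖ := by
    refine Summable.of_nonneg_of_le (fun _ => norm_nonneg _) (fun p => ?_)
      (he.mul_right (Real.exp (2 * ‖x‖)))
    rw [norm_mul]
    gcongr
    exact norm_exp_le x p.1
  refine ((summable_norm_div_one_sub hu).mul_left 2).congr fun p => ?_
  rw [norm_mul (2 * σ p.2 * blockEigenvalue p.1), norm_mul, norm_mul, norm_sign (hσ _),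
    norm_blockEigenvalue]
  simp

end blockSystem

lemma hasSum_prod_of_fintype {κ β : Type*} [Fintype κ] {α : Type*} [AddCommMonoid α]
    [TopologicalSpace α] [ContinuousAdd α] {f : κ × β → α} {g : κ → α}
    (h : ∀ k, HasSum (fun b => f (k, b)) (g k)) : HasSum f (∑ k, g k) := by
  classical
  have h' : ∀ k, HasSum (fun p : κ × β => if p.1 = k then f p else 0) (g k) := by
    intro k
    have hinj : Function.Injective fun b : β => (k, b) := Prod.mk_right_injective k
    refine (hinj.hasSum_iff ?_).1 (by simpa [Function.comp_def] using h k)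
    rintro ⟨k', b⟩ hp
    rw [if_neg]
    rintro rfl
    exact hp ⟨b, rfl⟩
  simpa using hasSum_sum (s := Finset.univ) fun k _ => h' k

/-! ### Theta functions as determinants and traces. -/

/-- Each theta function contributes the geometric sequence `q^{2n+1} e^{±2id}`. -/
noncomputable def thetaEntry (ω d : ℂ) (i : Fin 2) (n : ℕ) : ℂ :=
  nome ω * cexp (2 * blockEigenvalue i * d) * (nome ω ^ 2) ^ n

lemma thetaEntry_mul_exp (ω d x : ℂ) (i : Fin 2) (n : ℕ) :
    thetaEntry ω d i n * cexp (-2 * blockEigenvalue i * x) =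
      nome ω * cexp (-2 * blockEigenvalue i * (x - d)) * (nome ω ^ 2) ^ n := by
  rw [thetaEntry, show -2 * blockEigenvalue i * (x - d) =
    2 * blockEigenvalue i * d + -2 * blockEigenvalue i * x by ring, Complex.exp_add]
  ring

lemma thetaProd_eq_prod (ω x : ℂ) : thetaProd ω x =
    ∏ i, qProd (nome ω ^ 2) (nome ω * cexp (-2 * blockEigenvalue i * x)) := by
  simp [thetaProd, blockEigenvalue, mul_comm]

lemma summable_norm_thetaEntry {ω : ℂ} (hω : 0 < ω.im) (d : ℂ) (i : Fin 2) :
    Summable fun n => ‖thetaEntry ω d i n‖ :=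
  summable_norm_mul_pow (norm_nome_sq_lt_one hω) _

/-- The determinant formula for the product of theta type. -/
lemma exists_hasDet_thetaProd {ω : ℂ} (hω : 0 < ω.im) :
    ∃ T : BlockPeriodicLinearSystem, (∀ n, (T.block n).ε = 1) ∧
      ∀ x, T.HasDet x (thetaProd ω x) := by
  have he : Summable fun p : Fin 2 × ℕ => ‖thetaEntry ω 0 p.1 p.2‖ :=
    (hasSum_prod_of_fintype (f := fun p : Fin 2 × ℕ => ‖thetaEntry ω 0 p.1 p.2‖)
      fun i => (summable_norm_thetaEntry hω 0 i).hasSum).summable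
  refine ⟨blockSystem _ he (fun _ => 1) fun _ => Or.inl rfl, fun _ => rfl, fun x => ?_⟩
  rw [BlockPeriodicLinearSystem.HasDet]
  simp only [blockSystem, diagonalSystem_det_pencil, thetaEntry_mul_exp, sub_zero]
  rw [thetaProd_eq_prod]
  exact hasProd_prod fun i _ => hasProd_qProd (norm_nome_sq_lt_one hω) _

lemma hasDerivAt_nome_mul_exp (ω x : ℂ) (i : Fin 2) :
    HasDerivAt (fun x => nome ω * cexp (-2 * blockEigenvalue i * x))
      (-2 * blockEigenvalue i * (nome ω * cexp (-2 * blockEigenvalue i * x))) x :=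
  (((hasDerivAt_id x).const_mul (-2 * blockEigenvalue i)).cexp.const_mul _).congr_deriv
    (by simp; ring)

/-- Logarithmic differentiation of the product formula, in which `κ` drops out. Nonvanishing of `θ(x
- d)` is what keeps every factor away from zero. -/
lemma hasSum_logDeriv_ellipticTheta {ω : ℂ} (hω : 0 < ω.im) {x d : ℂ}
    (hx : ellipticTheta ω (x - d) ≠ 0) :
    (∀ i n, 1 - thetaEntry ω d i n * cexp (-2 * blockEigenvalue i * x) ≠ 0) ∧
    HasSum (fun p : Fin 2 × ℕ => 2 * blockEigenvalue p.1 *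
      (thetaEntry ω d p.1 p.2 * cexp (-2 * blockEigenvalue p.1 * x) /
        (1 - thetaEntry ω d p.1 p.2 * cexp (-2 * blockEigenvalue p.1 * x))))
      (logDeriv (ellipticTheta ω) (x - d)) := by
  have hp := norm_nome_sq_lt_one hω
  obtain ⟨κ, hκ, h⟩ := exists_thetaProd_eq_mul_ellipticTheta hω
  have h0 : thetaProd ω (x - d) ≠ 0 := by rw [h]; exact mul_ne_zero hκ hx
  rw [thetaProd_eq_prod, Finset.prod_ne_zero_iff] at h0
  have hq := fun i => h0 i (Finset.mem_univ i)
  refine ⟨fun i n hn => ?_, ?_⟩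
  · rw [thetaEntry_mul_exp] at hn
    exact hq i ((qProd_eq_zero_iff hp).2 ⟨n, hn⟩)
  · have hL : logDeriv (ellipticTheta ω) (x - d) = ∑ i, 2 * blockEigenvalue i *
        (-(nome ω * cexp (-2 * blockEigenvalue i * (x - d))) *
          logDeriv (qProd (nome ω ^ 2)) (nome ω * cexp (-2 * blockEigenvalue i * (x - d)))) := by
      rw [← logDeriv_const_mul (x - d) κ hκ, ← funext h, funext (thetaProd_eq_prod ω),
        logDeriv_prod (s := Finset.univ)
          (f := fun i x => qProd (nome ω ^ 2) (nome ω * cexp (-2 * blockEigenvalue i * x)))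
          (fun i _ => hq i)
          (fun i _ => ((differentiable_qProd hp) _).comp (x - d)
            (hasDerivAt_nome_mul_exp ω (x - d) i).differentiableAt)]
      refine Finset.sum_congr rfl fun i _ => ?_
      rw [show (fun x => qProd (nome ω ^ 2) (nome ω * cexp (-2 * blockEigenvalue i * x))) =
        qProd (nome ω ^ 2) ∘ fun x => nome ω * cexp (-2 * blockEigenvalue i * x) from rfl,
        logDeriv_comp (differentiable_qProd hp _)
          (hasDerivAt_nome_mul_exp ω (x - d) i).differentiableAt,
        (hasDerivAt_nome_mul_exp ω (x - d) i).deriv]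
      ring
    rw [hL]
    refine hasSum_prod_of_fintype fun i => ?_
    simp only [thetaEntry_mul_exp]
    exact (hasSum_logDeriv_qProd hp (hq i)).mul_left _

/-- Sums of logarithmic derivatives of theta functions are traces. -/
lemma exists_hasTrace_sum_logDeriv {ω : ℂ} (hω : 0 < ω.im) {J : Type*} [Fintype J] (d σ : J → ℂ)
    (hσ : ∀ j, σ j = 1 ∨ σ j = -1) :
    ∃ S : BlockPeriodicLinearSystem, ∀ x, (∀ j, ellipticTheta ω (x - d j) ≠ 0) →
      S.Regular x ∧
        (S.W x x).HasTrace (∑ j, σ j * logDeriv (ellipticTheta ω) (x - d j)) := by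
  -- Without theta functions there are no blocks to enumerate, and a system with `E = 0` has trace
  -- `0`.
  rcases isEmpty_or_nonempty J with hJ | hJ
  · refine ⟨blockSystem (fun _ => 0) (by simp) (fun _ => 1)
      fun _ => Or.inl rfl, fun x _ => ⟨blockSystem_regular _ _ (by simp),
      blockSystem_hasTrace _ _ (by simp) (by simp)⟩⟩
  -- The systems for the various `j` are interleaved along a bijection of block numbers. All sums
  -- are unordered, so reindexing by `ψ` is harmless.
  · obtain ⟨φ⟩ : Nonempty (ℕ ≃ J × ℕ) := inferInstance
    let ψ : J × (Fin 2 × ℕ) ≃ Fin 2 × ℕ :=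
      { toFun := fun p => (p.2.1, φ.symm (p.1, p.2.2))
        invFun := fun p => ((φ p.2).1, p.1, (φ p.2).2)
        left_inv := fun p => by simp
        right_inv := fun p => by simp }
    let e : Fin 2 × ℕ → ℂ := fun p => thetaEntry ω (d (φ p.2).1) p.1 (φ p.2).2
    have he : Summable fun p => ‖e p‖ := by
      have h : HasSum (fun p : J × (Fin 2 × ℕ) => ‖thetaEntry ω (d p.1) p.2.1 p.2.2‖) _ :=
        hasSum_prod_of_fintype fun j => hasSum_prod_of_fintype fun i =>
          (summable_norm_thetaEntry hω (d j) i).hasSum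
      exact ψ.summable_iff.1 (h.summable.congr fun p => by simp [ψ, e])
    refine ⟨blockSystem e he (fun n => σ (φ n).1) fun n => hσ _, fun x hx => ?_⟩
    have hθ := fun j => hasSum_logDeriv_ellipticTheta hω (hx j)
    have hne : ∀ p, 1 - e p * cexp (-2 * blockEigenvalue p.1 * x) ≠ 0 := fun p =>
      (hθ _).1 p.1 _
    refine ⟨blockSystem_regular _ _ hne, blockSystem_hasTrace _ _ hne ?_⟩
    rw [← ψ.hasSum_iff]
    refine hasSum_prod_of_fintype fun j => ?_
    convert! (hθ j).2.mul_left (σ j) using 2 with p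
    simp only [Function.comp_apply, ψ, e, Equiv.coe_fn_mk, Equiv.apply_symm_apply]
    ring

/-! ### The main theorem. -/

theorem theorem11p3 (ω₁ ω₂ : ℂ) (τ : ℂ → ℂ) (hτ : IsElliptic ω₁ ω₂ τ) :
    -- the logarithmic derivative of `τ`, in the variable normalised to period `π`, is a trace
    (∃ S : BlockPeriodicLinearSystem,
      ∀ x : ℂ, AnalyticAt ℂ τ (ω₁ / (Real.pi : ℂ) * x) → τ (ω₁ / (Real.pi : ℂ) * x) ≠ 0 →
        S.Regular x ∧
        (S.W x x).HasTrace (logDeriv (fun z => τ (ω₁ / (Real.pi : ℂ) * z)) x)) ∧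
    -- `τ` is a quotient of shifted theta functions
    (∃ (m : ℕ) (a b : Fin m → ℂ) (c : ℂ), c ≠ 0 ∧ ∑ j, a j = ∑ j, b j ∧
      ∀ x : ℂ, AnalyticAt ℂ τ (ω₁ / (Real.pi : ℂ) * x) →
        (∀ j, ellipticTheta (ω₂ / ω₁) (x - b j) ≠ 0) ∧
        τ (ω₁ / (Real.pi : ℂ) * x) =
          c * ∏ j, (ellipticTheta (ω₂ / ω₁) (x - a j) / ellipticTheta (ω₂ / ω₁) (x - b j))) ∧
    -- the theta function is a determinant
    (∃ T : BlockPeriodicLinearSystem, (∀ n, (T.block n).ε = 1) ∧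
      ∃ κ : ℂ, κ ≠ 0 ∧ ∀ x : ℂ, T.HasDet x (κ * ellipticTheta (ω₂ / ω₁) x)) := by
  have hω := hτ.im_pos
  have hpi : (Real.pi : ℂ) ≠ 0 := by exact_mod_cast Real.pi_ne_zero
  have hω₁ : ω₁ ≠ 0 := by
    rintro rfl
    simp at hω
  set ω := ω₂ / ω₁ with hωdef
  set f : ℂ → ℂ := fun z => τ (ω₁ / (Real.pi : ℂ) * z) with hf
  have hfan : ∀ x, AnalyticAt ℂ τ (ω₁ / (Real.pi : ℂ) * x) → AnalyticAt ℂ f x := fun x hx =>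
    AnalyticAt.fun_comp (f := fun z => ω₁ / (Real.pi : ℂ) * z) hx (by fun_prop)
  obtain ⟨m, a, b, c, hc, hsum, hfac⟩ := exists_eq_prod_ellipticTheta hω (f := f)
    (fun x => (hτ.meromorphic _).comp_analyticAt (g := fun z => ω₁ / (Real.pi : ℂ) * z)
      (by fun_prop))
    (fun x => by
      simp only [hf]
      exact (congrArg τ (by field_simp)).trans (hτ.periodic₁ _))
    (fun x => by
      simp only [hf]
      exact (congrArg τ (by rw [hωdef]; field_simp)).trans (hτ.periodic₂ _))
    (by
      obtain ⟨y, hy, hy0⟩ := hτ.ne_zero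
      have e : ω₁ / (Real.pi : ℂ) * (Real.pi / ω₁ * y) = y := by field_simp
      exact ⟨Real.pi / ω₁ * y, hfan _ (e.symm ▸ hy), by simpa only [hf, e] using hy0⟩)
  refine ⟨?_, ⟨m, a, b, c, hc, hsum, fun x hx => hfac x (hfan x hx)⟩, ?_⟩
  -- Sign `+1` for the zeros `a`, sign `-1` for the poles `b`.
  · obtain ⟨S, hS⟩ := exists_hasTrace_sum_logDeriv hω (Sum.elim a b)
      (Sum.elim (fun _ => 1) fun _ => -1) (by rintro (j | j) <;> simp)
    refine ⟨S, fun x hx hx0 => ?_⟩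
    obtain ⟨hb, hfx⟩ := hfac x (hfan x hx)
    have hab : ∀ j, ellipticTheta ω (x - a j) / ellipticTheta ω (x - b j) ≠ 0 := by
      have h1 : f x ≠ 0 := hx0
      rw [hfx] at h1
      exact fun j => Finset.prod_ne_zero_iff.1 (right_ne_zero_of_mul h1) j (Finset.mem_univ j)
    have ha : ∀ j, ellipticTheta ω (x - a j) ≠ 0 := fun j h0 => hab j (by rw [h0, zero_div])
    have hθ : ∀ c : ℂ, DifferentiableAt ℂ (fun x => ellipticTheta ω (x - c)) x := fun c =>
      (differentiable_ellipticTheta hω _).comp x (by fun_prop)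
    have hθl : ∀ c : ℂ, logDeriv (fun x => ellipticTheta ω (x - c)) x =
        logDeriv (ellipticTheta ω) (x - c) := fun c => by
      rw [logDeriv_apply, logDeriv_apply, deriv_comp_sub_const]
    -- Analyticity is an open condition, so the factorization holds near `x` and may be
    -- differentiated.
    have hev : f =ᶠ[𝓝 x] fun x =>
        c * ∏ j, (ellipticTheta ω (x - a j) / ellipticTheta ω (x - b j)) := by
      filter_upwards [(hfan x hx).eventually_analyticAt] with y hy
      exact (hfac y hy).2
    have hlog : logDeriv f x = ∑ j : Fin m ⊕ Fin m,
        Sum.elim (fun _ => 1) (fun _ => -1) j *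
          logDeriv (ellipticTheta ω) (x - Sum.elim a b j) := by
      rw [(logDeriv_congr_nhds hev).eq_of_nhds, logDeriv_const_mul x c hc,
        logDeriv_prod (fun j _ => hab j) (fun j _ => (hθ _).fun_div (hθ _) (hb j)),
        Fintype.sum_sum_type, ← Finset.sum_add_distrib]
      refine Finset.sum_congr rfl fun j _ => ?_
      rw [logDeriv_div x (ha j) (hb j) (hθ _) (hθ _), hθl, hθl]
      simp [sub_eq_add_neg]
    rw [hlog]
    exact hS x (by rintro (j | j) <;> simp [ha, hb])
  · obtain ⟨T, hT, hdet⟩ := exists_hasDet_thetaProd hω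
    obtain ⟨κ, hκ, h⟩ := exists_thetaProd_eq_mul_ellipticTheta hω
    exact ⟨T, hT, κ, hκ, fun x => h x ▸ hdet x⟩
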